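/- Conventions. All graphs are finite and simple, $\log$ is to base $2$, and $g\simeq h$ means that $g$ and $h$ are adjacent or equal. The strong product $G\boxtimes H$ has $(g,h)\simeq(g',h')$ iff $g\simeq g'$ and $h\simeq h'$, and $G^{\boxtimes n}$ is the $n$-th strong power, with vertex set $V(G)^n$. A spectral point is a function $f$ from finite graphs to $\mathbb{R}_{\ge 0}$ with $f(G\sqcup H)=f(G)+f(H)$, $f(G\boxtimes H)=f(G)f(H)$, $f(\overline{K_d})=d$, and $f(H)\le f(G)$ whenever there is a homomorphism $\overline{H}\to\overline{G}$. Its logarithmic probabilistic refinement is $$F(G,P)=\lim_{n\to\infty}\tfrac1n\log f\big(G^{\boxtimes n}[T^n_{P^{(n)}}]\big),$$ where $P$ is a probability distribution on $V(G)$, $P^{(n)}$ is any sequence of $n$-types converging to $P$, and $T^n_{Q}\subseteq V(G)^n$ is the set of words of type $Q$ (the limit exists and is the same for all such sequences). Let $\mu$ be a probability measure on $V(G)^\infty$ with marginals $\mu_{1\ldots n}$ on $V(G)^n$. The pair $(G,\mu)$ has the asymptotic equipartition property (AEP) if for every spectral point $f$ the limit $$\lim_{n\to\infty}\ \min_{S\subseteq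 V(G)^n,\ \mu_{1\ldots n}(S)\ge c}\ \tfrac1n\log f(G^{\boxtimes n}[S])$$ exists for all $c\in(0,1)$ and is independent of $c$. The $F$-rate of $(G,\mu)$ is $\overline{F}(G,\mu)=\lim_{n\to\infty}\frac1n F(G^{\boxtimes n},\mu_{1\ldots n})$, if this limit exists. Theorem. Let $\mathcal{Z}$ be a finite set, $G$ a graph, $\varphi:\mathcal{Z}\to V(G)$ a function, and $\mu$ a probability measure on $\mathcal{Z}^\infty$. Let $\varphi^*(G)$ be the graph on $\mathcal{Z}$ in which distinct $z_1,z_2$ are adjacent iff $\varphi(z_1)\simeq\varphi(z_2)$, and let $\varphi^\infty_*(\mu)$ be the image of $\mu$ under the letterwise application of $\varphi$. Then: 1. $(G,\varphi^\infty_*(\mu))$ has the AEP iff $(\varphi^*(G),\mu)$ has the AEP. 2. For every spectral point $f$, if either of the $F$-rates $\overline{F}(G,\varphi^\infty_*(\mu))$ and $\overline{F}(\varphi^*(G),\mu)$ exists, then so does the other, and the two are equal. 3. In particular, if $\mu$ is the law of a stationary Markov chain that is irreducible on the support of its stationary distribution, then $(G,\varphi^\infty_*(\mu))$ has the AEP;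 moreover, for every spectral point $f$, the $F$-rate $\overline{F}(G,\varphi^\infty_*(\mu))$ exists and is the value of the limit in the definition of the AEP for every $c\in(0,1)$. -/

import Mathlib

open Filter Topology MeasureTheory

universe u

/-- `H ≤ G` for confusability graphs: there is a map of vertices sending distinguishable pairs to
distinguishable pairs, i.e. a homomorphism between the complements. -/
def CohomLE {W V : Type*} (H : SimpleGraph W) (G : SimpleGraph V) : Prop :=
  Nonempty (Hᶜ →g Gᶜ)

/-- Strong product: `(v, w) ≃ (v', w')` iff `v ≃ v'` and `w ≃ w'`, where `≃` means adjacent or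
equal. -/
def strongProd {V W : Type*} (G : SimpleGraph V) (H : SimpleGraph W) : SimpleGraph (V × W) where
  Adj p q := p ≠ q ∧ (G.Adj p.1 q.1 ∨ p.1 = q.1) ∧ (H.Adj p.2 q.2 ∨ p.2 = q.2)
  symm := ⟨fun _ _ h => ⟨h.1.symm, h.2.1.imp (fun a => a.symm) Eq.symm,
    h.2.2.imp (fun a => a.symm) Eq.symm⟩⟩
  loopless := ⟨fun _ h => h.1 rfl⟩

/-- Strong power `G^{⊠ n}` on words of length `n`: two words are adjacent or equal iff they are so
in every coordinate. -/
def strongPow {V : Type*} (G : SimpleGraph V) (n : ℕ) : SimpleGraph (Fin n → V) where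
  Adj x y := x ≠ y ∧ ∀ i, G.Adj (x i) (y i) ∨ x i = y i
  symm := ⟨fun _ _ h => ⟨h.1.symm, fun i => (h.2 i).imp (fun a => a.symm) Eq.symm⟩⟩
  loopless := ⟨fun _ h => h.1 rfl⟩

/-- Pullback `φ^*(G)` of a confusability graph: distinct `z`, `w` are adjacent iff `φ z` and `φ w`
are adjacent or equal. -/
def pullbackGraph {Z V : Type*} (φ : Z → V) (G : SimpleGraph V) : SimpleGraph Z where
  Adj z w := z ≠ w ∧ (G.Adj (φ z) (φ w) ∨ φ z = φ w)
  symm := ⟨fun _ _ h => ⟨h.1.symm, h.2.imp (fun a => a.symm) Eq.symm⟩⟩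
  loopless := ⟨fun _ h => h.1 rfl⟩

/-- A point of the asymptotic spectrum of graphs: a nonnegative real parameter of finite graphs,
additive under disjoint union, multiplicative under the strong product, monotone, and normalized
on edgeless graphs. -/
structure SpectralPoint where
  val : ∀ {V : Type u} [Finite V], SimpleGraph V → ℝ
  nonneg : ∀ {V : Type u} [Finite V] (G : SimpleGraph V), 0 ≤ val G
  disjointUnion : ∀ {V W : Type u} [Finite V] [Finite W] (G : SimpleGraph V) (H : SimpleGraph W),
    val (G.sum H) = val G + val H
  strongProduct : ∀ {V W : Type u} [Finite V] [Finite W] (G : SimpleGraph V) (H : SimpleGraph W),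
    val (strongProd G H) = val G * val H
  mono : ∀ {V W : Type u} [Finite V] [Finite W] (G : SimpleGraph V) (H : SimpleGraph W),
    CohomLE H G → val H ≤ val G
  edgeless : ∀ d : ℕ, val (⊥ : SimpleGraph (ULift.{u} (Fin d))) = d

section Types

variable {V : Type u}

/-- `Q` is an `n`-type: a probability distribution with all `n * Q a` integers. -/
def IsNType [Fintype V] (n : ℕ) (Q : V → ℝ) : Prop :=
  Q ∈ stdSimplex ℝ V ∧ ∀ a, ∃ k : ℕ, (n : ℝ) * Q a = k

/-- The type class of `Q`: the words of length `n` in which each letter `a` occurs exactly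
`n * Q a` times. -/
def typeClass (n : ℕ) (Q : V → ℝ) : Set (Fin n → V) :=
  {x | ∀ a, (Nat.card {i // x i = a} : ℝ) = n * Q a}

/-- `F(G, P) = L` for the logarithmic probabilistic refinement `F` of `f`: for every sequence of
`n`-types `Q n` converging to `P`, one has `(1/n) log f (G^{⊠ n}[T_{Q n}]) → L`. -/
def HasRefinement [Fintype V] (f : SpectralPoint.{u}) (G : SimpleGraph V) (P : V → ℝ) (L : ℝ) :
    Prop :=
  ∀ Q : ℕ → V → ℝ, (∀ n, IsNType n (Q n)) → Tendsto Q atTop (𝓝 P) →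
    Tendsto (fun n : ℕ =>
      (1 / (n : ℝ)) * Real.logb 2 (f.val ((strongPow G n).induce (typeClass n (Q n)))))
      atTop (𝓝 L)

end Types

section Processes

variable {V : Type u} [Fintype V] [MeasurableSpace V]

/-- Probability mass function of the marginal on the first `n` letters. -/
noncomputable def marginal (μ : Measure (ℕ → V)) (n : ℕ) (w : Fin n → V) : ℝ :=
  μ.real {x | (fun i : Fin n => x i) = w}

/-- Minimum of `(1/n) log f (G^{⊠ n}[S])` over the sets `S` of words of length `n` that have
probability at least `c`. -/
noncomputable def minLogRate (f : SpectralPoint.{u}) (G : SimpleGraph V) (μ : Measure (ℕ → V))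
    (c : ℝ) (n : ℕ) : ℝ :=
  ⨅ S : {S : Set (Fin n → V) // c ≤ μ.real {x | (fun i : Fin n => x i) ∈ S}},
    (1 / (n : ℝ)) * Real.logb 2 (f.val ((strongPow G n).induce S.1))

/-- The asymptotic equipartition property of a source with confusability graph `G`: for every
spectral point the limit of `minLogRate` exists and does not depend on `c ∈ (0, 1)`. -/
def HasAEP (G : SimpleGraph V) (μ : Measure (ℕ → V)) : Prop :=
  ∀ f : SpectralPoint.{u}, ∃ L : ℝ, ∀ c ∈ Set.Ioo (0 : ℝ) 1,
    Tendsto (minLogRate f G μ c) atTop (𝓝 L)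

/-- The `F`-rate of `(G, μ)` exists and equals `R`: the values `a n = F(G^{⊠ n}, μ_{1…n})` satisfy
`a n / n → R`. -/
def HasFRate (f : SpectralPoint.{u}) (G : SimpleGraph V) (μ : Measure (ℕ → V)) (R : ℝ) : Prop :=
  ∃ a : ℕ → ℝ, (∀ n, HasRefinement f (strongPow G n) (marginal μ n) (a n)) ∧
    Tendsto (fun n : ℕ => (1 / (n : ℝ)) * a n) atTop (𝓝 R)

/-- `μ` is the law of a stationary Markov chain with initial distribution `p` and transition
probabilities `W`, irreducible on the support of `p`. -/
def IsIrreducibleStationaryMarkov (μ : Measure (ℕ → V)) : Prop :=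
  ∃ (p : V → ℝ) (W : V → V → ℝ),
    p ∈ stdSimplex ℝ V ∧ (∀ a, W a ∈ stdSimplex ℝ V) ∧
    (∀ b, ∑ a, p a * W a b = p b) ∧
    (∀ a b, 0 < p a → 0 < p b → Relation.ReflTransGen (fun s t => 0 < W s t) a b) ∧
    ∀ (n : ℕ) (w : Fin (n + 1) → V),
      marginal μ (n + 1) w = p (w 0) * ∏ i : Fin n, W (w i.castSucc) (w i.succ)

end Processes

/-!
The idea of the proof.

Write `f.on H S` for the value of the spectral point `f` on the subgraph of `H` induced by `S`. It is
monotone under maps that preserve distinguishability (`SpectralPoint.on_le_on`), subadditive under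
unions, and at least `1` on nonempty sets.

*Pullback.* In a strong power of `pullbackGraph φ G` two words are distinguishable exactly if their
images in the power of `G` are. Hence a set and its image have the same value
(`SpectralPoint.on_image`). This identifies the minima in the definition of the equipartition
property (`SpectralPoint.minLog_pullback`), and, as `φ` maps type classes onto type classes, it also
identifies the refinements (`HasRefinement.pullback`). In the second case one direction only concerns
types that come from `Z`. The other direction follows because the refinement always exists
(`SpectralPoint.exists_isUniformRefinement`) and is unique (`HasRefinement.unique`). For existence,
the logarithm of the value of a type class is superadditive in the letter counts, and inserting few
letters changes it little (`SpectralPoint.countVal_add_le`), so Fekete's lemma along the rounded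
multiples of `P` gives the limit.

*Markov chains.* Let `F k` be the refinement of `G^{⊠ k}` at the law of a block of length `k`. If the
chain of blocks of length `k` is irreducible, its letter frequencies obey a law of large numbers
(`IsStationaryChain.eventually_mass_compl_typicalSet_le`): the compensated numbers of visits are
martingales, so the empirical law is almost stationary, and hence close to the unique stationary law.
The typical words form polynomially many type classes, so the cheapest sets of weight `c` have
rate at most `F k / k` (`IsStationaryChain.eventually_minLog_le`). Conversely, per block the chain
has density at most `C` with respect to independent blocks, with `C` not depending on `k`. A set of
weight `c` therefore contains a share `C ^ (-m)` of a type class of words of `m` blocks, up to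
polynomial factors. The class is homogeneous under permutations of the blocks, so it is covered by
correspondingly few permuted copies of that share (`SpectralPoint.on_le_mul_of_transitive`), and the
rate is at least `(F k - log C) / k` (`IsStationaryChain.eventually_le_minLog`).

The block chain is irreducible when every letter of the support has a closed walk of length `k - 1`
(`IsStationaryChain.block`), which holds for all `k` congruent to `1` modulo a fixed number. Along
these `k` the two bounds meet, and monotonicity of `F` extends the convergence of `F k / k` to all
`k` (`IsIrreducibleStationaryMarkov.exists_rate`).
-/

/-! ### Spectral points on induced subgraphs -/

section SpectralBasics

variable {X Y : Type u}

/-- The value of the spectral point `f` on the subgraph of `H` induced by `S`. -/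
noncomputable def SpectralPoint.on [Finite X] (f : SpectralPoint.{u}) (H : SimpleGraph X)
    (S : Set X) : ℝ :=
  f.val (H.induce S)

variable [Finite X] [Finite Y] (f : SpectralPoint.{u}) (H : SimpleGraph X) (K : SimpleGraph Y)

variable {H K} in
/-- Monotonicity under maps that preserve distinguishability, i.e. adjacency in the complement. -/
lemma SpectralPoint.on_le_on {S : Set X} {T : Set Y} (m : X → Y) (hm : ∀ x ∈ S, m x ∈ T)
    (h : ∀ x ∈ S, ∀ y ∈ S, Hᶜ.Adj x y → Kᶜ.Adj (m x) (m y)) : f.on H S ≤ f.on K T := by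
  refine f.mono _ _ ⟨⟨fun x => ⟨m x, hm x x.2⟩, ?_⟩⟩
  intro x y hxy
  have h1 : Hᶜ.Adj x y := by
    rw [SimpleGraph.compl_adj] at hxy ⊢
    exact ⟨fun e => hxy.1 (Subtype.ext e), hxy.2⟩
  have h2 := h x x.2 y y.2 h1
  rw [SimpleGraph.compl_adj] at h2 ⊢
  exact ⟨fun e => h2.1 (congrArg Subtype.val e), h2.2⟩

variable {H} in
lemma SpectralPoint.on_mono {S T : Set X} (h : S ⊆ T) : f.on H S ≤ f.on H T :=
  f.on_le_on id h (fun _ _ _ _ h => h)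

lemma SpectralPoint.on_union_le (S T : Set X) : f.on H (S ∪ T) ≤ f.on H S + f.on H T := by
  classical
  unfold SpectralPoint.on
  rw [← f.disjointUnion]
  refine f.mono _ _ ⟨⟨fun x => if h : x.1 ∈ S then Sum.inl ⟨x, h⟩ else
    Sum.inr ⟨x, x.2.resolve_left h⟩, ?_⟩⟩
  rintro ⟨x, hx⟩ ⟨y, hy⟩ hxy
  rw [SimpleGraph.compl_adj] at hxy ⊢
  have hne : x ≠ y := fun e => hxy.1 (Subtype.ext e)
  have hna : ¬ H.Adj x y := hxy.2
  by_cases h1 : x ∈ S <;> by_cases h2 : y ∈ S <;> simp [h1, h2, hne, hna]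

lemma SpectralPoint.on_empty : f.on H ∅ = 0 := by
  have h0 : f.val (⊥ : SimpleGraph (ULift.{u} (Fin 0))) = 0 := by simpa using f.edgeless 0
  refine le_antisymm ?_ (f.nonneg _)
  rw [← h0]
  exact f.mono _ _ ⟨⟨fun x => (x.2).elim, fun {x} => (x.2).elim⟩⟩

lemma SpectralPoint.on_singleton_le (x : X) : f.on H {x} ≤ 1 := by
  have h0 : f.val (⊥ : SimpleGraph (ULift.{u} (Fin 1))) = 1 := by simpa using f.edgeless 1
  rw [← h0]
  refine f.mono _ _ ⟨⟨fun _ => ⟨0⟩, fun {a b} h => ?_⟩⟩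
  exact (h.ne (Subsingleton.elim a b)).elim

variable {H} in
lemma SpectralPoint.one_le_on {S : Set X} (h : S.Nonempty) : 1 ≤ f.on H S := by
  obtain ⟨x, hx⟩ := h
  have h0 : f.val (⊥ : SimpleGraph (ULift.{u} (Fin 1))) = 1 := by simpa using f.edgeless 1
  rw [← h0]
  refine f.mono _ _ ⟨⟨fun _ => ⟨x, hx⟩, fun {a b} h => ?_⟩⟩
  exact (h.ne (Subsingleton.elim a b)).elim

variable {H} in
lemma SpectralPoint.on_pos {S : Set X} (h : S.Nonempty) : 0 < f.on H S :=
  zero_lt_one.trans_le (f.one_le_on h)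

lemma SpectralPoint.on_biUnion_le {ι : Type*} (s : Finset ι) (S : ι → Set X) :
    f.on H (⋃ i ∈ s, S i) ≤ ∑ i ∈ s, f.on H (S i) := by
  classical
  induction s using Finset.induction_on with
  | empty => simp [f.on_empty]
  | insert a s ha ih =>
    rw [Finset.set_biUnion_insert, Finset.sum_insert ha]
    exact (f.on_union_le H _ _).trans (by gcongr)

lemma SpectralPoint.on_le_card (S : Finset X) : f.on H S ≤ S.card := by
  have h := f.on_biUnion_le H S (fun x => {x})
  rw [show (⋃ i ∈ S, ({i} : Set X)) = S by ext; simp] at h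
  exact h.trans ((Finset.sum_le_sum fun x _ => f.on_singleton_le H x).trans (by simp))

variable {H K} in
/-- A set is worth as much as its image under a map that preserves and reflects
distinguishability. -/
lemma SpectralPoint.on_image (m : X → Y) (S : Set X)
    (h : ∀ x ∈ S, ∀ y ∈ S, Hᶜ.Adj x y ↔ Kᶜ.Adj (m x) (m y)) : f.on K (m '' S) = f.on H S := by
  classical
  apply le_antisymm
  · rcases S.eq_empty_or_nonempty with rfl | ⟨x0, -⟩
    · simp [f.on_empty]
    have key : ∀ y, ∃ x, y ∈ m '' S → x ∈ S ∧ m x = y := fun y => by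
      by_cases hy : y ∈ m '' S
      · obtain ⟨x, hx⟩ := hy
        exact ⟨x, fun _ => hx⟩
      · exact ⟨x0, fun h => (hy h).elim⟩
    choose s hs using key
    refine f.on_le_on s (fun y hy => (hs y hy).1) fun y hy z hz hyz => ?_
    rw [h _ (hs y hy).1 _ (hs z hz).1, (hs y hy).2, (hs z hz).2]
    exact hyz
  · exact f.on_le_on m (fun x hx => ⟨x, hx, rfl⟩) fun x hx y hy => (h x hx y hy).1

end SpectralBasics

/-! ### Covering by translates under a transitive group action -/

section Covering

/-- Averaging over a transitive group action: some translate of `S` meets `U` in at least its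
proportional share. -/
lemma exists_smul_inter_card {Γ X : Type*} [Group Γ] [Fintype Γ] [MulAction Γ X] [DecidableEq X]
    (T S U : Finset X) (hST : S ⊆ T) (hUT : U ⊆ T) (hS : ∀ x ∈ T, ∀ y ∈ T, ∃ g : Γ, g • x = y)
    (hT : ∀ x ∈ T, ∀ g : Γ, g • x ∈ T) :
    ∃ g : Γ, U.card * S.card ≤ T.card * (U.filter fun u => g⁻¹ • u ∈ S).card := by
  classical
  have count : ∀ s ∈ T, ∀ u ∈ T,
      T.card * (Finset.univ.filter fun g : Γ => g⁻¹ • u = s).card = Fintype.card Γ := by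
    intro s hs u hu
    have e : ∀ u' ∈ T, (Finset.univ.filter fun g : Γ => g⁻¹ • u' = s).card
        = (Finset.univ.filter fun g : Γ => g⁻¹ • u = s).card := by
      intro u' hu'
      obtain ⟨k, hk⟩ := hS u' hu' u hu
      refine Finset.card_bij (fun g _ => k * g) ?_ ?_ ?_
      · intro g hg
        simp only [Finset.mem_filter, Finset.mem_univ, true_and] at hg ⊢
        rw [mul_inv_rev, mul_smul, ← hk, inv_smul_smul, hg]
      · intro a _ b _ hab
        exact mul_left_cancel hab
      · intro b hb
        simp only [Finset.mem_filter, Finset.mem_univ, true_and] at hb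
        refine ⟨k⁻¹ * b, ?_, by simp⟩
        simp only [Finset.mem_filter, Finset.mem_univ, true_and]
        rw [mul_inv_rev, inv_inv, mul_smul, hk, hb]
    have hsum : ∑ u' ∈ T, (Finset.univ.filter fun g : Γ => g⁻¹ • u' = s).card
        = Fintype.card Γ := by
      rw [← Finset.card_univ]
      have hmap : ∀ g ∈ (Finset.univ : Finset Γ), g • s ∈ T := fun g _ => hT s hs g
      rw [Finset.card_eq_sum_card_fiberwise hmap]
      refine Finset.sum_congr rfl fun u' _ => congrArg _ (Finset.filter_congr fun g _ => ?_)
      rw [inv_smul_eq_iff, eq_comm]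
    rw [← hsum, Finset.sum_congr rfl e, Finset.sum_const, smul_eq_mul]
  by_contra! hcon
  have h1 : ∑ g : Γ, T.card * (U.filter fun u => g⁻¹ • u ∈ S).card
      < ∑ _g : Γ, U.card * S.card :=
    Finset.sum_lt_sum_of_nonempty ⟨1, Finset.mem_univ _⟩ fun g _ => hcon g
  have h2 : ∑ g : Γ, (U.filter fun u => g⁻¹ • u ∈ S).card
      = ∑ u ∈ U, ∑ s ∈ S, (Finset.univ.filter fun g : Γ => g⁻¹ • u = s).card := by
    simp_rw [Finset.card_filter]
    rw [Finset.sum_comm]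
    refine Finset.sum_congr rfl fun u _ => ?_
    rw [Finset.sum_comm]
    refine Finset.sum_congr rfl fun g _ => ?_
    rw [Finset.sum_ite_eq]
  rw [← Finset.mul_sum, h2, Finset.mul_sum] at h1
  simp_rw [Finset.mul_sum] at h1
  rw [Finset.sum_congr rfl fun u hu => Finset.sum_congr rfl fun s hs =>
    count s (hST hs) u (hUT hu)] at h1
  simp only [Finset.sum_const, smul_eq_mul, Finset.card_univ] at h1
  apply lt_irrefl _ (lt_of_lt_of_eq h1 _)
  ring

/-- Greedy covering of a homogeneous set `T` by translates of `S`: after `t` translates the part of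
`U` left uncovered has shrunk by the factor `(1 - 1 / κ) ^ t`. -/
lemma SpectralPoint.on_le_of_transitive {Γ : Type*} {X : Type u} [Group Γ] [Fintype Γ]
    [Finite X] [MulAction Γ X] (f : SpectralPoint.{u}) (H : SimpleGraph X)
    (hH : ∀ (g : Γ) (x y : X), Hᶜ.Adj x y → Hᶜ.Adj (g • x) (g • y))
    (T S : Finset X) (hST : S ⊆ T) (hS : ∀ x ∈ T, ∀ y ∈ T, ∃ g : Γ, g • x = y)
    (hT : ∀ x ∈ T, ∀ g : Γ, g • x ∈ T) (κ : ℝ) (hκ : 0 < κ) (hcard : (T.card : ℝ) ≤ κ * S.card)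
    (t : ℕ) (U : Finset X) (hU : U ⊆ T) :
    f.on H U ≤ t * f.on H S + U.card * (1 - 1 / κ) ^ t := by
  classical
  induction t generalizing U with
  | zero => simpa using f.on_le_card H U
  | succ t ih =>
    rcases S.eq_empty_or_nonempty with rfl | hSne
    · have : T = ∅ := by
        rw [← Finset.card_eq_zero]
        have : (T.card : ℝ) ≤ 0 := by simpa using hcard
        exact_mod_cast le_antisymm this (Nat.cast_nonneg _)
      subst this
      rw [Finset.subset_empty] at hU
      subst hU
      simp [f.on_empty]
    have hTpos : 0 < (T.card : ℝ) := by
      exact_mod_cast (hSne.mono hST).card_pos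
    have hSle : (S.card : ℝ) ≤ T.card := by exact_mod_cast Finset.card_le_card hST
    have hSpos : 0 < (S.card : ℝ) := by exact_mod_cast hSne.card_pos
    have hκ1 : 1 ≤ κ := by
      by_contra! h
      nlinarith
    obtain ⟨g, hg⟩ := exists_smul_inter_card T S U hST hU hS hT
    set A := U.filter fun u => g⁻¹ • u ∈ S with hA
    have hA1 : f.on H A ≤ f.on H S := by
      refine f.on_le_on (fun x => g⁻¹ • x) (fun x hx => ?_) fun x _ y _ h => hH _ _ _ h
      rw [hA] at hx
      exact_mod_cast (Finset.mem_filter.1 (Finset.mem_coe.1 hx)).2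
    have hsplit : (U : Set X) = (A : Set X) ∪ ((U \ A : Finset X) : Set X) := by
      rw [← Finset.coe_union, Finset.union_sdiff_of_subset (Finset.filter_subset _ _)]
    have hle := f.on_union_le H A ((U \ A : Finset X) : Set X)
    rw [← hsplit] at hle
    have hih := ih (U \ A) (Finset.sdiff_subset.trans hU)
    have hUA : ((U \ A).card : ℝ) ≤ U.card * (1 - 1 / κ) := by
      have h1 : ((U \ A).card : ℝ) = U.card - A.card := by
        rw [Finset.card_sdiff_of_subset (Finset.filter_subset _ _),
          Nat.cast_sub (Finset.card_le_card (Finset.filter_subset _ _))]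
      have h2 : (U.card : ℝ) * S.card ≤ T.card * A.card := by exact_mod_cast hg
      have h3 : (U.card : ℝ) / κ ≤ A.card := by
        rw [div_le_iff₀ hκ]
        have h4 : (T.card : ℝ) * A.card ≤ κ * S.card * A.card := by gcongr
        have h5 : (U.card : ℝ) * S.card ≤ (A.card * κ) * S.card := by nlinarith
        exact le_of_mul_le_mul_right h5 hSpos
      rw [h1, mul_sub, mul_one, mul_one_div]
      linarith
    have hk0 : 0 ≤ 1 - 1 / κ := by
      rw [sub_nonneg, div_le_one hκ]
      exact hκ1
    have hmul : ((U \ A).card : ℝ) * (1 - 1 / κ) ^ t ≤ U.card * (1 - 1 / κ) ^ (t + 1) := by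
      rw [pow_succ']
      calc _ ≤ (U.card * (1 - 1 / κ)) * (1 - 1 / κ) ^ t := by gcongr
        _ = _ := by ring
    push_cast
    linarith

/-- A subset of proportion `1 / κ` of a homogeneous set `T` is worth as much as `T` up to the
factor `κ` and a factor logarithmic in the cardinality. -/
lemma SpectralPoint.on_le_mul_of_transitive {Γ : Type*} {X : Type u} [Group Γ] [Fintype Γ]
    [Finite X] [MulAction Γ X] (f : SpectralPoint.{u}) (H : SimpleGraph X)
    (hH : ∀ (g : Γ) (x y : X), Hᶜ.Adj x y → Hᶜ.Adj (g • x) (g • y))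
    (T S : Finset X) (hST : S ⊆ T) (hS : ∀ x ∈ T, ∀ y ∈ T, ∃ g : Γ, g • x = y)
    (hT : ∀ x ∈ T, ∀ g : Γ, g • x ∈ T) (κ : ℝ) (hκ : 1 ≤ κ) (hcard : (T.card : ℝ) ≤ κ * S.card)
    (hne : S.Nonempty) (b : ℝ) (hb0 : 0 ≤ b) (hb : (T.card : ℝ) ≤ Real.exp b) :
    f.on H T ≤ κ * (b + 2) * f.on H S := by
  have hκ0 : 0 < κ := by linarith
  have h := f.on_le_of_transitive H hH T S hST hS hT κ hκ0 hcard ⌈κ * b⌉₊ T subset_rfl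
  have h1 : (1 - 1 / κ) ^ ⌈κ * b⌉₊ ≤ Real.exp (-b) := by
    have h2 : (1 - 1 / κ) ≤ Real.exp (-(1 / κ)) := by
      have := Real.add_one_le_exp (-(1 / κ))
      linarith
    have h3 : 0 ≤ 1 - 1 / κ := by
      rw [sub_nonneg, div_le_one hκ0]; exact hκ
    calc (1 - 1 / κ) ^ ⌈κ * b⌉₊ ≤ Real.exp (-(1 / κ)) ^ ⌈κ * b⌉₊ := by gcongr
      _ = Real.exp (-(⌈κ * b⌉₊ / κ)) := by rw [← Real.exp_nat_mul]; congr 1; ring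
      _ ≤ Real.exp (-b) := by
        apply Real.exp_le_exp.2
        rw [neg_le_neg_iff, le_div_iff₀ hκ0, mul_comm]
        exact Nat.le_ceil _
  have h4 : (T.card : ℝ) * (1 - 1 / κ) ^ ⌈κ * b⌉₊ ≤ 1 := by
    calc _ ≤ Real.exp b * Real.exp (-b) := by
          gcongr
          have h3 : 0 ≤ 1 - 1 / κ := by
            rw [sub_nonneg, div_le_one hκ0]; exact hκ
          positivity
      _ = 1 := by rw [← Real.exp_add]; simp
  have h5 : (⌈κ * b⌉₊ : ℝ) ≤ κ * b + 1 := (Nat.ceil_lt_add_one (by positivity)).le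
  have h6 : 1 ≤ f.on H S := f.one_le_on (by exact_mod_cast hne)
  have h7 : (⌈κ * b⌉₊ : ℝ) * f.on H S ≤ (κ * b + 1) * f.on H S := by gcongr
  have h8 : f.on H S ≤ κ * f.on H S := by nlinarith
  nlinarith

end Covering

/-! ### Words with prescribed letter counts -/

section CountClasses

variable {V : Type u}

/-- The strong power of `G` with coordinates indexed by an arbitrary type `I`; for `I = Fin n` it is
`strongPow G n`. -/
def powGraph (G : SimpleGraph V) (I : Type) : SimpleGraph (I → V) where
  Adj x y := x ≠ y ∧ ∀ i, G.Adj (x i) (y i) ∨ x i = y i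
  symm := ⟨fun _ _ h => ⟨h.1.symm, fun i => (h.2 i).imp (fun a => a.symm) Eq.symm⟩⟩
  loopless := ⟨fun _ h => h.1 rfl⟩

lemma strongPow_eq_powGraph (G : SimpleGraph V) (n : ℕ) : strongPow G n = powGraph G (Fin n) := rfl

lemma powGraph_compl_adj {G : SimpleGraph V} {I : Type} {x y : I → V} :
    (powGraph G I)ᶜ.Adj x y ↔ ∃ i, Gᶜ.Adj (x i) (y i) := by
  simp only [SimpleGraph.compl_adj, powGraph]
  constructor
  · rintro ⟨h1, h2⟩
    by_contra! h3
    exact h2 ⟨h1, fun i => by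
      by_cases h4 : x i = y i
      · exact Or.inr h4
      · exact Or.inl (h3 i h4)⟩
  · rintro ⟨i, h1, h2⟩
    refine ⟨fun h => h1 (congrFun h i), fun h => ?_⟩
    rcases h.2 i with h3 | h3
    · exact h2 h3
    · exact h1 h3

lemma strongProd_compl_adj {W : Type u} {G : SimpleGraph V} {H : SimpleGraph W} {p q : V × W}
    (h : (strongProd G H)ᶜ.Adj p q) : Gᶜ.Adj p.1 q.1 ∨ Hᶜ.Adj p.2 q.2 := by
  simp only [SimpleGraph.compl_adj, strongProd] at h ⊢
  grind

/-- The words over the index set `I` in which each letter `a` occurs exactly `c a` times. -/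
def countClass (I : Type) (c : V → ℕ) : Set (I → V) := {x | ∀ a, Nat.card {i // x i = a} = c a}

lemma typeClass_eq_countClass {n : ℕ} {Q : V → ℝ} {c : V → ℕ} (h : ∀ a, (n : ℝ) * Q a = c a) :
    typeClass n Q = countClass (Fin n) c := by
  ext x
  simp only [typeClass, countClass, Set.mem_ofPred_eq, h, Nat.cast_inj]

lemma comp_mem_countClass {I J : Type} (e : I ≃ J) {c : V → ℕ} {x : J → V} :
    x ∘ e ∈ countClass I c ↔ x ∈ countClass J c := by
  simp only [countClass, Set.mem_ofPred_eq]
  refine forall_congr' fun a => ?_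
  rw [← Nat.card_congr (e.subtypeEquiv (p := fun i => (x ∘ e) i = a) (q := fun j => x j = a)
    fun i => Iff.rfl)]

lemma exists_perm_of_mem_countClass {I : Type} [Finite I] {c : V → ℕ} {x y : I → V}
    (hx : x ∈ countClass I c) (hy : y ∈ countClass I c) : ∃ σ : Equiv.Perm I, x ∘ σ = y := by
  have e : ∀ a, Nonempty ({i // y i = a} ≃ {i // x i = a}) := fun a =>
    Finite.card_eq.1 ((hy a).trans (hx a).symm)
  refine ⟨Equiv.ofFiberEquiv fun a => (e a).some, ?_⟩
  ext i
  exact Equiv.ofFiberEquiv_map _ i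

lemma sumElim_mem_countClass {I J : Type} [Finite I] [Finite J] {c d : V → ℕ} {x : I → V}
    {y : J → V} (hx : x ∈ countClass I c) (hy : y ∈ countClass J d) :
    Sum.elim x y ∈ countClass (I ⊕ J) (c + d) := by
  intro a
  rw [Nat.card_congr Equiv.subtypeSum, Nat.card_sum, Pi.add_apply, ← hx a, ← hy a]
  rfl

lemma countClass_nonempty [Fintype V] {I : Type} [Finite I] {c : V → ℕ}
    (h : Nat.card I = ∑ a, c a) : (countClass I c).Nonempty := by
  classical
  have : Nonempty (I ≃ Σ a, Fin (c a)) :=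
    Finite.card_eq.1 (by simp [h])
  obtain ⟨e⟩ := this
  refine ⟨fun i => (e i).1, fun a => ?_⟩
  rw [Nat.card_congr (e.subtypeEquiv (q := fun j => j.1 = a) fun i => Iff.rfl),
    Nat.card_congr (Equiv.sigmaSubtype a), Nat.card_eq_fintype_card, Fintype.card_fin]

lemma card_eq_of_mem_countClass [Fintype V] {I : Type} [Finite I] {c : V → ℕ} {x : I → V}
    (h : x ∈ countClass I c) : Nat.card I = ∑ a, c a := by
  rw [← Nat.card_congr (Equiv.sigmaFiberEquiv x), Nat.card_sigma]
  exact Finset.sum_congr rfl fun a _ => h a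

end CountClasses

section CountValue

variable {V : Type u} [Fintype V] (f : SpectralPoint.{u}) (G : SimpleGraph V)

lemma SpectralPoint.on_countClass_congr {I J : Type} [Finite I] [Finite J]
    (e : I ≃ J) (c : V → ℕ) :
    f.on (powGraph G I) (countClass I c) ≤ f.on (powGraph G J) (countClass J c) := by
  refine f.on_le_on (fun x => x ∘ e.symm) (fun x hx => (comp_mem_countClass e.symm).2 hx) ?_
  intro x _ y _ h
  rw [powGraph_compl_adj] at h ⊢
  obtain ⟨i, hi⟩ := h
  exact ⟨e i, by simpa using hi⟩

/-- The value of `f` on the class of words with letter counts `c`. -/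
noncomputable def SpectralPoint.countVal (c : V → ℕ) : ℝ :=
  f.on (powGraph G (Fin (∑ a, c a))) (countClass _ c)

lemma SpectralPoint.on_countClass {I : Type} [Finite I] {c : V → ℕ} (h : Nat.card I = ∑ a, c a) :
    f.on (powGraph G I) (countClass I c) = f.countVal G c := by
  obtain ⟨e⟩ : Nonempty (I ≃ Fin (∑ a, c a)) := Finite.card_eq.1 (by simpa using h)
  exact le_antisymm (f.on_countClass_congr G e c) (f.on_countClass_congr G e.symm c)

lemma SpectralPoint.one_le_countVal (c : V → ℕ) : 1 ≤ f.countVal G c :=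
  f.one_le_on (countClass_nonempty (by simp))

lemma SpectralPoint.countVal_pos (c : V → ℕ) : 0 < f.countVal G c :=
  zero_lt_one.trans_le (f.one_le_countVal G c)

lemma SpectralPoint.countVal_le (c : V → ℕ) :
    f.countVal G c ≤ (Fintype.card V : ℝ) ^ (∑ a, c a) := by
  classical
  refine (f.on_mono (Set.subset_univ _)).trans ?_
  rw [← Finset.coe_univ]
  exact (f.on_le_card _ _).trans (by simp)

lemma SpectralPoint.countVal_mul_le (c d : V → ℕ) :
    f.countVal G c * f.countVal G d ≤ f.countVal G (c + d) := by
  rw [← f.on_countClass G (I := Fin (∑ a, c a) ⊕ Fin (∑ a, d a)) (c := c + d)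
    (by simp [Finset.sum_add_distrib])]
  unfold SpectralPoint.countVal
  unfold SpectralPoint.on
  rw [← f.strongProduct]
  refine f.mono _ _ ⟨⟨fun p => ⟨Sum.elim p.1.1 p.2.1, sumElim_mem_countClass p.1.2 p.2.2⟩, ?_⟩⟩
  rintro ⟨⟨x, hx⟩, ⟨y, hy⟩⟩ ⟨⟨x', hx'⟩, ⟨y', hy'⟩⟩ h
  have key : (powGraph G (Fin (∑ a, c a) ⊕ Fin (∑ a, d a)))ᶜ.Adj (Sum.elim x y) (Sum.elim x' y') := by
    rw [powGraph_compl_adj]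
    rcases strongProd_compl_adj h with h | h
    · have h' : (powGraph G (Fin (∑ a, c a)))ᶜ.Adj x x' := by
        simpa [SimpleGraph.compl_adj] using h
      obtain ⟨i, hi⟩ := powGraph_compl_adj.1 h'
      exact ⟨Sum.inl i, hi⟩
    · have h' : (powGraph G (Fin (∑ a, d a)))ᶜ.Adj y y' := by
        simpa [SimpleGraph.compl_adj] using h
      obtain ⟨i, hi⟩ := powGraph_compl_adj.1 h'
      exact ⟨Sum.inr i, hi⟩
  simpa [SimpleGraph.compl_adj] using key

/-- Inserting `d` further letters into words with counts `c` multiplies the value of `f` by at most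
the number of ways to choose the positions and contents of the inserted letters. That number is the
number of partial colourings with `∑ d` coloured positions, estimated through the generating
function `(1 + |V| x) ^ n` of all partial colourings. -/
lemma SpectralPoint.countVal_add_le (c d : V → ℕ) {x : ℝ} (hx : 0 < x) :
    f.countVal G (c + d) * x ^ (∑ a, d a) ≤
      (1 + Fintype.card V * x) ^ (∑ a, c a + ∑ a, d a) * f.countVal G c := by
  classical
  set J := Fin (∑ a, c a)
  set K := Fin (∑ a, d a)
  obtain ⟨v, hv⟩ : (countClass K d).Nonempty := countClass_nonempty (by simp [K])
  obtain ⟨u0, hu0⟩ : (countClass J c).Nonempty := countClass_nonempty (by simp [J])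
  -- A colouring `χ` prescribes the letters at the inserted positions.
  let χ₀ : J ⊕ K → Option V := Sum.elim (fun _ => none) (fun k => some (v k))
  let cls : (J ⊕ K → Option V) → Set (J ⊕ K → V) := fun χ =>
    {w | (∀ i a, χ i = some a → w i = a) ∧ (fun i : {i // χ i = none} => w i) ∈ countClass _ c}
  let X : Finset (J ⊕ K → Option V) :=
    Finset.univ.image fun σ : Equiv.Perm (J ⊕ K) => χ₀ ∘ σ
  have hcover : countClass (J ⊕ K) (c + d) ⊆ ⋃ χ ∈ X, cls χ := by
    intro w hw
    obtain ⟨σ, hσ⟩ := exists_perm_of_mem_countClass (sumElim_mem_countClass hu0 hv) hw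
    refine Set.mem_biUnion (x := χ₀ ∘ σ) (by simp [X]) ⟨fun i a hi => ?_, ?_⟩
    · rw [← hσ]
      simp only [Function.comp_apply] at hi ⊢
      rcases h : σ i with j | k <;> simp [h, χ₀] at hi ⊢
      exact hi
    · let e : J ≃ {i // (χ₀ ∘ σ) i = none} := Equiv.ofBijective
        (fun j => ⟨σ.symm (Sum.inl j), by simp [χ₀]⟩) ⟨fun j j' h => by simpa using h, by
          rintro ⟨i, hi⟩
          rcases h : σ i with j | k
          · exact ⟨j, by simp [← h]⟩
          · simp [h, χ₀] at hi⟩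
      rw [← comp_mem_countClass e]
      convert hu0 using 1
      ext j
      change w (σ.symm (Sum.inl j)) = u0 j
      simp [← hσ]
  have hcls : ∀ χ ∈ X, f.on (powGraph G (J ⊕ K)) (cls χ) ≤ f.countVal G c := by
    intro χ _
    by_cases hne : (cls χ).Nonempty
    · obtain ⟨w0, hw0⟩ := hne
      rw [← f.on_countClass G (card_eq_of_mem_countClass hw0.2)]
      refine f.on_le_on (fun w i => w i.1) (fun w hw => hw.2) fun w hw w' hw' h => ?_
      rw [powGraph_compl_adj] at h ⊢
      obtain ⟨i, hi⟩ := h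
      rcases hχ : χ i with _ | a
      · exact ⟨⟨i, hχ⟩, hi⟩
      · rw [hw.1 i a hχ, hw'.1 i a hχ] at hi
        exact (hi.ne rfl).elim
    · rw [Set.not_nonempty_iff_eq_empty.1 hne, f.on_empty]
      exact (f.countVal_pos G c).le
  have hval : f.countVal G (c + d) ≤ X.card * f.countVal G c := by
    rw [← f.on_countClass G (I := J ⊕ K) (c := c + d)
      (by simp [Finset.sum_add_distrib, J, K])]
    refine (f.on_mono hcover).trans ((f.on_biUnion_le _ _ _).trans ?_)
    exact (Finset.sum_le_sum hcls).trans (by simp)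
  let wt : Option V → ℝ := fun o => o.elim 1 fun _ => x
  have hwt : ∀ o, 0 ≤ wt o := by
    rintro (_ | a) <;> simp [wt, hx.le]
  have hX : ∀ χ ∈ X, ∏ i, wt (χ i) = x ^ (∑ a, d a) := by
    intro χ hχ
    obtain ⟨σ, -, rfl⟩ := Finset.mem_image.1 hχ
    simp only [Function.comp_apply]
    rw [Equiv.prod_comp σ fun i => wt (χ₀ i), Fintype.prod_sum_type]
    simp [wt, χ₀, K]
  have hcount : (X.card : ℝ) * x ^ (∑ a, d a) ≤
      (1 + Fintype.card V * x) ^ (∑ a, c a + ∑ a, d a) := by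
    calc (X.card : ℝ) * x ^ (∑ a, d a) = ∑ χ ∈ X, ∏ i, wt (χ i) := by
          rw [Finset.sum_congr rfl hX]; simp
      _ ≤ ∑ χ : J ⊕ K → Option V, ∏ i, wt (χ i) :=
          Finset.sum_le_univ_sum_of_nonneg fun χ => Finset.prod_nonneg fun i _ => hwt _
      _ = ∏ _i : J ⊕ K, ∑ o : Option V, wt o := by
          rw [Finset.prod_univ_sum, Fintype.piFinset_univ]
      _ = _ := by simp [Fintype.sum_option, wt, J, K]
  calc _ ≤ (X.card * f.countVal G c) * x ^ (∑ a, d a) := by gcongr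
    _ = (X.card * x ^ (∑ a, d a)) * f.countVal G c := by ring
    _ ≤ _ := mul_le_mul_of_nonneg_right hcount (f.countVal_pos G c).le

end CountValue

/-! ### Existence and uniqueness of the probabilistic refinement -/

section Refinement

variable {V : Type u} [Fintype V] (f : SpectralPoint.{u}) (G : SimpleGraph V)

/-- Binary logarithm of the value of `f` on the class of words with letter counts `c`. -/
noncomputable def SpectralPoint.logCount (c : V → ℕ) : ℝ := Real.logb 2 (f.countVal G c)

lemma SpectralPoint.logCount_nonneg (c : V → ℕ) : 0 ≤ f.logCount G c :=
  Real.logb_nonneg one_lt_two (f.one_le_countVal G c)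

lemma SpectralPoint.logCount_le (c : V → ℕ) :
    f.logCount G c ≤ (∑ a, c a : ℕ) * Real.logb 2 (Fintype.card V) := by
  rw [← Real.logb_pow]
  exact Real.logb_le_logb_of_le one_lt_two (f.countVal_pos G c) (f.countVal_le G c)

lemma SpectralPoint.logCount_add_le (c d : V → ℕ) :
    f.logCount G c + f.logCount G d ≤ f.logCount G (c + d) := by
  unfold SpectralPoint.logCount
  rw [← Real.logb_mul (f.countVal_pos G c).ne' (f.countVal_pos G d).ne']
  exact Real.logb_le_logb_of_le one_lt_two
    (mul_pos (f.countVal_pos G c) (f.countVal_pos G d)) (f.countVal_mul_le G c d)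

lemma SpectralPoint.logCount_mono {c d : V → ℕ} (h : c ≤ d) :
    f.logCount G c ≤ f.logCount G d := by
  have h1 := f.logCount_add_le G c (d - c)
  rw [add_tsub_cancel_of_le h] at h1
  linarith [f.logCount_nonneg G (d - c)]

/-- Inserting a small proportion of letters costs little: the parameter of the generating function
in `countVal_add_le` is taken small depending on `ε`. -/
lemma SpectralPoint.logCount_le_add {ε : ℝ} (hε : 0 < ε) : ∃ K : ℝ, 0 ≤ K ∧ ∀ c d : V → ℕ,
    f.logCount G (c + d) ≤
      f.logCount G c + ε * (∑ a, c a + ∑ a, d a : ℕ) + K * (∑ a, d a : ℕ) := by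
  have hlim : Tendsto (fun x : ℝ => Real.logb 2 (1 + Fintype.card V * x)) (𝓝[>] 0) (𝓝 0) := by
    have : ContinuousAt (fun x : ℝ => Real.logb 2 (1 + Fintype.card V * x)) 0 := by
      apply ContinuousAt.logb <;> first | fun_prop | norm_num
    have h2 := this.tendsto
    simp only [mul_zero, add_zero, Real.logb_one] at h2
    exact h2.mono_left nhdsWithin_le_nhds
  obtain ⟨x, hxε, hx0, hx1⟩ := ((hlim.eventually (gt_mem_nhds hε)).and
    (Ioo_mem_nhdsGT (zero_lt_one (α := ℝ)))).exists
  refine ⟨-Real.logb 2 x, by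
    have := Real.logb_nonpos one_lt_two hx0.le hx1.le
    linarith, fun c d => ?_⟩
  have h := f.countVal_add_le G c d hx0
  have hpos : (0 : ℝ) < 1 + Fintype.card V * x := by positivity
  have h2 := Real.logb_le_logb_of_le one_lt_two
    (mul_pos (f.countVal_pos G (c + d)) (pow_pos hx0 _)) h
  rw [Real.logb_mul (f.countVal_pos G _).ne' (pow_pos hx0 _).ne',
    Real.logb_mul (pow_pos hpos _).ne' (f.countVal_pos G _).ne', Real.logb_pow,
    Real.logb_pow] at h2
  have h3 : ((∑ a, c a + ∑ a, d a : ℕ) : ℝ) * Real.logb 2 (1 + Fintype.card V * x) ≤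
      ε * (∑ a, c a + ∑ a, d a : ℕ) := by
    rw [mul_comm]
    gcongr
  unfold SpectralPoint.logCount
  linarith

/-- Quasi-Lipschitz estimate: changing few letters changes `logCount` by little. -/
lemma SpectralPoint.logCount_le_sub {ε : ℝ} (hε : 0 < ε) : ∃ K : ℝ, 0 ≤ K ∧ ∀ c d : V → ℕ,
    f.logCount G d ≤
      f.logCount G c + ε * (∑ a, c a + ∑ a, d a : ℕ) + K * (∑ a, (d a - c a) : ℕ) := by
  obtain ⟨K, hK, h⟩ := f.logCount_le_add G hε
  refine ⟨K, hK, fun c d => ?_⟩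
  have h1 : f.logCount G d ≤ f.logCount G (c + (d - c)) :=
    f.logCount_mono G le_add_tsub
  have h2 := h c (d - c)
  have h3 : (∑ a, c a + ∑ a, (d - c) a : ℕ) ≤ ∑ a, c a + ∑ a, d a := by
    gcongr
    simp
  have h4 : ε * ((∑ a, c a + ∑ a, (d - c) a : ℕ) : ℝ) ≤ ε * ((∑ a, c a + ∑ a, d a : ℕ) : ℝ) := by
    gcongr
  simp only [Pi.sub_apply] at h2 h4
  linarith

/-- `L` is the logarithmic refinement `F(G, P)` in a form uniform over all letter counts
approximately proportional to `P`. -/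
def SpectralPoint.IsUniformRefinement (P : V → ℝ) (L : ℝ) : Prop :=
  ∀ ε > 0, ∃ δ > 0, ∃ N : ℕ, ∀ n ≥ N, ∀ c : V → ℕ, ∑ a, c a = n →
    (∀ a, |(c a : ℝ) - n * P a| ≤ δ * n) → |f.logCount G c - n * L| ≤ ε * n

/-- Along the rounded multiples `⌊n P⌋` the logarithm is superadditive, so that Fekete's lemma gives
a limit; the quasi-Lipschitz estimate carries it over to all nearby letter counts. -/
lemma SpectralPoint.exists_isUniformRefinement {P : V → ℝ} (hP : P ∈ stdSimplex ℝ V) :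
    ∃ L, f.IsUniformRefinement G P L := by
  let fl : ℕ → V → ℕ := fun n a => ⌊n * P a⌋₊
  let h : ℕ → ℝ := fun n => f.logCount G (fl n)
  have hP0 : ∀ a, 0 ≤ P a := hP.1
  have hfl1 : ∀ (n : ℕ) a, (fl n a : ℝ) ≤ n * P a := fun n a =>
    Nat.floor_le (mul_nonneg n.cast_nonneg (hP0 a))
  have hfl2 : ∀ (n : ℕ) a, (n : ℝ) * P a ≤ fl n a + 1 := fun n a => (Nat.lt_floor_add_one _).le
  have hflsum : ∀ n, ∑ a, fl n a ≤ n := by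
    intro n
    have : ((∑ a, fl n a : ℕ) : ℝ) ≤ n := by
      push_cast
      refine (Finset.sum_le_sum fun a _ => hfl1 n a).trans ?_
      rw [← Finset.mul_sum, hP.2, mul_one]
    exact_mod_cast this
  have hsub : Subadditive fun n => -h n := by
    intro m n
    have h1 : fl m + fl n ≤ fl (m + n) := by
      intro a
      refine Nat.le_floor ?_
      simp only [Pi.add_apply]
      push_cast
      linarith [hfl1 m a, hfl1 n a]
    have h2 := f.logCount_mono G h1
    have h3 := f.logCount_add_le G (fl m) (fl n)
    simp only [h]
    linarith
  have hV : Nonempty V := by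
    by_contra hV
    rw [not_nonempty_iff] at hV
    simpa using hP.2
  have hlogV : 0 ≤ Real.logb 2 (Fintype.card V) :=
    Real.logb_nonneg one_lt_two (by exact_mod_cast Fintype.card_pos)
  have hbdd : BddBelow (Set.range fun n => -h n / n) := by
    refine ⟨-Real.logb 2 (Fintype.card V), ?_⟩
    rintro _ ⟨n, rfl⟩
    dsimp only
    rcases n.eq_zero_or_pos with rfl | hn
    · simpa using hlogV
    rw [neg_div, neg_le_neg_iff, div_le_iff₀ (by exact_mod_cast hn), mul_comm]
    refine (f.logCount_le G _).trans ?_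
    gcongr
    exact hflsum n
  have hlim := hsub.tendsto_lim hbdd
  set M := hsub.lim with hM
  refine ⟨-M, fun ε hε => ?_⟩
  obtain ⟨K, hK, hcomp⟩ := f.logCount_le_sub G (show 0 < ε / 8 by positivity)
  set k : ℝ := K * Fintype.card V with hk
  have hk0 : 0 ≤ k := by positivity
  refine ⟨ε / (4 * (k + 1)), by positivity, ?_⟩
  have hev : ∀ᶠ n : ℕ in atTop, |(-h n / n) - M| < ε / 4 := by
    have := (Metric.tendsto_nhds.1 hlim) (ε / 4) (by positivity)
    simpa [Real.dist_eq] using this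
  obtain ⟨N, hN⟩ := eventually_atTop.1 (hev.and
    ((eventually_gt_atTop 0).and (tendsto_natCast_atTop_atTop.eventually_ge_atTop (4 * k / ε))))
  refine ⟨N, fun n hn c hc hcP => ?_⟩
  obtain ⟨h1, h2, h3⟩ := hN n hn
  have hn0 : (0 : ℝ) < n := by exact_mod_cast h2
  have h4 : k ≤ ε / 4 * n := by
    rw [div_le_iff₀ hε] at h3
    linarith
  have h5 : |h n + n * M| ≤ ε / 4 * n := by
    have : h n + n * M = -(n * (-h n / n - M)) := by field_simp; ring
    rw [this, abs_neg, abs_mul, abs_of_pos hn0, mul_comm]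
    gcongr
  set δ := ε / (4 * (k + 1)) with hδ
  have hkδ : k * δ ≤ ε / 4 := by
    rw [hδ, mul_div_assoc', div_le_div_iff₀ (by positivity) (by positivity)]
    nlinarith
  have hd : ∀ x y : V → ℕ, (∀ a, (x a : ℝ) ≤ y a + δ * n + 1) →
      K * (∑ a, (x a - y a) : ℕ) ≤ ε / 2 * n := by
    intro x y hxy
    have e1 : ((∑ a, (x a - y a) : ℕ) : ℝ) ≤ Fintype.card V * (δ * n + 1) := by
      push_cast
      calc ∑ a, ((x a - y a : ℕ) : ℝ) ≤ ∑ _a : V, (δ * n + 1) := by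
            refine Finset.sum_le_sum fun a _ => ?_
            rcases le_total (x a) (y a) with hle | hle
            · rw [Nat.sub_eq_zero_of_le hle]
              simp only [Nat.cast_zero]
              positivity
            · rw [Nat.cast_sub hle]
              linarith [hxy a]
        _ = _ := by rw [Finset.sum_const, Finset.card_univ, nsmul_eq_mul]
    calc _ ≤ K * (Fintype.card V * (δ * n + 1)) := by gcongr
      _ = (k * δ) * n + k := by rw [hk]; ring
      _ ≤ ε / 4 * n + ε / 4 * n := by gcongr
      _ = _ := by ring
  have hS : ε / 8 * ((∑ a, c a + ∑ a, fl n a : ℕ) : ℝ) ≤ ε / 4 * n := by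
    have : ((∑ a, c a + ∑ a, fl n a : ℕ) : ℝ) ≤ n + n := by
      rw [hc]
      exact_mod_cast Nat.add_le_add_left (hflsum n) n
    nlinarith
  have u1 := hcomp (fl n) c
  have u2 := hcomp c (fl n)
  have v1 := hd c (fl n) fun a => by
    have := (abs_le.1 (hcP a)).2
    linarith [hfl2 n a]
  have v2 := hd (fl n) c fun a => by
    have := (abs_le.1 (hcP a)).1
    linarith [hfl1 n a]
  rw [add_comm (∑ a, fl n a)] at u1
  have h6 := abs_le.1 h5
  simp only [h] at h6
  rw [abs_le]
  constructor <;> linarith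

lemma IsNType.exists_count {n : ℕ} {Q : V → ℝ} (h : IsNType n Q) :
    ∃ c : V → ℕ, (∀ a, (n : ℝ) * Q a = c a) ∧ ∑ a, c a = n := by
  choose c hc using h.2
  refine ⟨c, hc, ?_⟩
  have : ((∑ a, c a : ℕ) : ℝ) = n := by
    push_cast
    simp_rw [← hc]
    rw [← Finset.mul_sum, h.1.2, mul_one]
  exact_mod_cast this

lemma SpectralPoint.logb_on_countClass {n : ℕ} {c : V → ℕ} (h : ∑ a, c a = n) :
    Real.logb 2 (f.on (powGraph G (Fin n)) (countClass (Fin n) c)) = f.logCount G c := by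
  rw [f.on_countClass G (by simp [h])]
  rfl

variable {f G} in
lemma SpectralPoint.IsUniformRefinement.hasRefinement {P : V → ℝ} {L : ℝ}
    (h : f.IsUniformRefinement G P L) : HasRefinement f G P L := by
  intro Q hQ hlim
  rw [Metric.tendsto_atTop]
  intro ε hε
  obtain ⟨δ, hδ, N, hN⟩ := h (ε / 2) (by positivity)
  obtain ⟨N', hN'⟩ := eventually_atTop.1 (Metric.tendsto_nhds.1 hlim δ hδ)
  refine ⟨max (max N N') 1, fun n hn => ?_⟩
  simp only [max_le_iff, ge_iff_le] at hn
  obtain ⟨⟨h1, h2⟩, h3⟩ := hn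
  have hn0 : (0 : ℝ) < n := by exact_mod_cast h3
  obtain ⟨c, hc, hcn⟩ := (hQ n).exists_count
  have hb := hN n h1 c hcn fun a => by
    rw [← hc, ← mul_sub, abs_mul, abs_of_pos hn0, mul_comm]
    have := (dist_le_pi_dist (Q n) P a).trans (hN' n h2).le
    rw [Real.dist_eq] at this
    gcongr
  have hval : Real.logb 2 (f.val ((strongPow G n).induce (typeClass n (Q n)))) =
      f.logCount G c := by
    rw [typeClass_eq_countClass hc]
    exact f.logb_on_countClass G hcn
  rw [hval, Real.dist_eq]
  have h6 : 1 / (n : ℝ) * f.logCount G c - L = (f.logCount G c - n * L) / n := by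
    field_simp
  rw [h6, abs_div, abs_of_pos hn0, div_lt_iff₀ hn0]
  nlinarith

lemma exists_isNType_tendsto {P : V → ℝ} (hP : P ∈ stdSimplex ℝ V) :
    ∃ Q : ℕ → V → ℝ, (∀ n, IsNType n (Q n)) ∧ Tendsto Q atTop (𝓝 P) := by
  classical
  have hV : Nonempty V := by
    by_contra hV
    rw [not_nonempty_iff] at hV
    simpa using hP.2
  obtain ⟨a₀⟩ := hV
  have hP0 : ∀ a, 0 ≤ P a := hP.1
  let fl : ℕ → V → ℕ := fun n a => ⌊n * P a⌋₊
  have hfl1 : ∀ (n : ℕ) a, (fl n a : ℝ) ≤ n * P a := fun n a =>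
    Nat.floor_le (mul_nonneg n.cast_nonneg (hP0 a))
  have hfl2 : ∀ (n : ℕ) a, (n : ℝ) * P a ≤ fl n a + 1 := fun n a => (Nat.lt_floor_add_one _).le
  have hsum : ∀ n : ℕ, ∑ a, (n : ℝ) * P a = n := fun n => by
    rw [← Finset.mul_sum, hP.2, mul_one]
  have hflsum : ∀ n, ∑ a, fl n a ≤ n := by
    intro n
    have : ((∑ a, fl n a : ℕ) : ℝ) ≤ n := by
      push_cast
      exact (Finset.sum_le_sum fun a _ => hfl1 n a).trans (hsum n).le
    exact_mod_cast this
  have hflsum2 : ∀ n : ℕ, (n : ℝ) ≤ ((∑ a, fl n a : ℕ) : ℝ) + Fintype.card V := by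
    intro n
    push_cast
    calc (n : ℝ) = ∑ a, (n : ℝ) * P a := (hsum n).symm
      _ ≤ ∑ a, ((fl n a : ℝ) + 1) := Finset.sum_le_sum fun a _ => hfl2 n a
      _ = _ := by simp [Finset.sum_add_distrib]
  -- Round down, and give the missing mass to one letter.
  let c : ℕ → V → ℕ := fun n a => fl n a + if a = a₀ then n - ∑ b, fl n b else 0
  have hc : ∀ n, ∑ a, c n a = n := by
    intro n
    simp only [c, Finset.sum_add_distrib, Finset.sum_ite_eq', Finset.mem_univ, if_true]
    have := hflsum n
    omega
  have hcP : ∀ n a, |(c n a : ℝ) - n * P a| ≤ Fintype.card V + 1 := by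
    intro n a
    have h0 : (0 : ℝ) ≤ ((if a = a₀ then n - ∑ b, fl n b else 0 : ℕ) : ℝ) := Nat.cast_nonneg _
    have h1 : ((if a = a₀ then n - ∑ b, fl n b else 0 : ℕ) : ℝ) ≤ Fintype.card V := by
      split_ifs
      · rw [Nat.cast_sub (hflsum n)]
        linarith [hflsum2 n]
      · simp
    have h2 : (c n a : ℝ) = fl n a + ((if a = a₀ then n - ∑ b, fl n b else 0 : ℕ) : ℝ) := by
      simp only [c]
      push_cast
      rfl
    rw [h2, abs_le]
    constructor <;> linarith [hfl1 n a, hfl2 n a]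
  refine ⟨fun n a => if n = 0 then P a else c n a / n, fun n => ?_, ?_⟩
  · rcases n.eq_zero_or_pos with rfl | hn
    · exact ⟨by simpa using hP, fun a => ⟨0, by simp⟩⟩
    · have hn0 : (0 : ℝ) < n := by exact_mod_cast hn
      simp only [hn.ne', if_false]
      refine ⟨⟨fun a => by positivity, ?_⟩, fun a => ⟨c n a, by field_simp⟩⟩
      rw [← Finset.sum_div, div_eq_one_iff_eq hn0.ne']
      exact_mod_cast hc n
  · rw [tendsto_pi_nhds]
    intro a
    rw [tendsto_iff_dist_tendsto_zero]
    refine squeeze_zero' (Eventually.of_forall fun n => dist_nonneg) ?_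
      (tendsto_const_div_atTop_nhds_zero_nat (Fintype.card V + 1 : ℝ))
    filter_upwards [eventually_gt_atTop 0] with n hn
    have hn0 : (0 : ℝ) < n := by exact_mod_cast hn
    have e : (c n a : ℝ) / n - P a = (c n a - n * P a) / n := by field_simp
    rw [if_neg hn.ne', Real.dist_eq, e, abs_div, abs_of_pos hn0]
    gcongr
    exact hcP n a

variable {f G} in
lemma HasRefinement.unique {P : V → ℝ} (hP : P ∈ stdSimplex ℝ V) {L L' : ℝ}
    (h : HasRefinement f G P L) (h' : HasRefinement f G P L') : L = L' := by
  obtain ⟨Q, hQ, hlim⟩ := exists_isNType_tendsto hP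
  exact tendsto_nhds_unique (h Q hQ hlim) (h' Q hQ hlim)

end Refinement

/-! ### Pullback graphs and image laws -/

section Pullback

variable {X Y : Type u}

lemma pullbackGraph_compl_adj {φ : X → Y} {H : SimpleGraph Y} {x y : X} :
    (pullbackGraph φ H)ᶜ.Adj x y ↔ Hᶜ.Adj (φ x) (φ y) := by
  simp only [SimpleGraph.compl_adj, pullbackGraph]
  grind

lemma strongPow_pullbackGraph (φ : X → Y) (H : SimpleGraph Y) (n : ℕ) :
    strongPow (pullbackGraph φ H) n = pullbackGraph (fun x => φ ∘ x) (strongPow H n) := by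
  rw [← compl_inj_iff]
  ext x y
  rw [pullbackGraph_compl_adj]
  simp only [strongPow_eq_powGraph, powGraph_compl_adj, pullbackGraph_compl_adj,
    Function.comp_apply]

/-- The image of the weight function `ν` under `φ`. -/
def pushWeight {M : Type*} [AddCommMonoid M] [Fintype X] [DecidableEq Y] (φ : X → Y) (ν : X → M) :
    Y → M :=
  fun b => ∑ a, if φ a = b then ν a else 0

lemma sum_pushWeight {M : Type*} [NonUnitalNonAssocSemiring M] [Fintype X] [Fintype Y]
    [DecidableEq Y] (φ : X → Y) (ν : X → M) (g : Y → M) :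
    ∑ b, pushWeight φ ν b * g b = ∑ a, ν a * g (φ a) := by
  simp only [pushWeight, Finset.sum_mul, ite_mul, zero_mul]
  rw [Finset.sum_comm]
  simp

lemma sum_pushWeight' {M : Type*} [AddCommMonoid M] [Fintype X] [Fintype Y]
    [DecidableEq Y] (φ : X → Y) (ν : X → M) :
    ∑ b, pushWeight φ ν b = ∑ a, ν a := by
  simp only [pushWeight]
  rw [Finset.sum_comm]
  simp

lemma pushWeight_mem_stdSimplex [Fintype X] [Fintype Y] [DecidableEq Y] (φ : X → Y) {P : X → ℝ}
    (h : P ∈ stdSimplex ℝ X) : pushWeight φ P ∈ stdSimplex ℝ Y :=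
  ⟨fun b => Finset.sum_nonneg fun a _ => by split_ifs; exacts [h.1 a, le_rfl],
    (sum_pushWeight' φ P).trans h.2⟩

lemma comp_mem_countClass_pushWeight [Fintype X] [DecidableEq Y] {I : Type} [Finite I] (φ : X → Y)
    {c : X → ℕ} {x : I → X} (hx : x ∈ countClass I c) :
    φ ∘ x ∈ countClass I (pushWeight φ c) := by
  classical
  have := Fintype.ofFinite I
  intro b
  have h1 : ∀ a, (Finset.univ.filter fun i => x i = a).card = c a := fun a => by
    rw [← hx a, Nat.card_eq_fintype_card, Fintype.card_subtype]
  rw [Nat.card_eq_fintype_card, Fintype.card_subtype,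
    Finset.card_eq_sum_card_fiberwise (t := Finset.univ) (f := x) fun _ _ => Finset.mem_univ _]
  refine Finset.sum_congr rfl fun a _ => ?_
  rw [Finset.filter_filter]
  split_ifs with h
  · rw [← h1 a]
    congr 1
    ext i
    simp only [Function.comp_apply, Finset.mem_filter, Finset.mem_univ, true_and,
      and_iff_right_iff_imp]
    rintro rfl
    exact h
  · rw [Finset.card_eq_zero, Finset.filter_eq_empty_iff]
    rintro i - ⟨h2, rfl⟩
    exact h h2

lemma image_countClass [Fintype X] [DecidableEq Y] {I : Type} [Finite I] (φ : X → Y) {c : X → ℕ}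
    (h : Nat.card I = ∑ a, c a) :
    (fun x : I → X => φ ∘ x) '' countClass I c = countClass I (pushWeight φ c) := by
  apply Set.Subset.antisymm
  · rintro _ ⟨x, hx, rfl⟩
    exact comp_mem_countClass_pushWeight φ hx
  · intro y hy
    obtain ⟨x, hx⟩ := countClass_nonempty h
    obtain ⟨σ, hσ⟩ := exists_perm_of_mem_countClass (comp_mem_countClass_pushWeight φ hx) hy
    exact ⟨x ∘ σ, (comp_mem_countClass σ).2 hx, hσ⟩

variable [Fintype X] [Fintype Y]

/-- Letterwise application of `φ` maps type classes onto type classes and preserves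
distinguishability, so that the refinement at the image law equals that of the pullback graph. -/
lemma HasRefinement.pullback [DecidableEq Y] {f : SpectralPoint.{u}} {H : SimpleGraph Y}
    (φ : X → Y) {P : X → ℝ} {L : ℝ} (h : HasRefinement f H (pushWeight φ P) L) :
    HasRefinement f (pullbackGraph φ H) P L := by
  intro Q hQ hlim
  have hcount : ∀ {n : ℕ} {c : X → ℕ}, (∀ a, (n : ℝ) * Q n a = c a) →
      ∀ b, (n : ℝ) * pushWeight φ (Q n) b = (pushWeight φ c b : ℕ) := by
    intro n c hc b
    simp only [pushWeight, Finset.mul_sum, mul_ite, mul_zero, hc]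
    push_cast
    rfl
  have h1 := h (fun n => pushWeight φ (Q n)) (fun n => by
    obtain ⟨c, hc, -⟩ := (hQ n).exists_count
    exact ⟨pushWeight_mem_stdSimplex φ (hQ n).1, fun b => ⟨_, hcount hc b⟩⟩) (by
    rw [tendsto_pi_nhds] at hlim ⊢
    intro b
    refine tendsto_finsetSum _ fun a _ => ?_
    split_ifs
    exacts [hlim a, tendsto_const_nhds])
  convert h1 using 5 with n
  obtain ⟨c, hc, hcn⟩ := (hQ n).exists_count
  change f.on (strongPow (pullbackGraph φ H) n) (typeClass n (Q n)) =
    f.on (strongPow H n) (typeClass n (pushWeight φ (Q n)))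
  rw [typeClass_eq_countClass hc, typeClass_eq_countClass (hcount hc),
    ← image_countClass φ (by simp [hcn])]
  refine (f.on_image (H := strongPow (pullbackGraph φ H) n) (fun x => φ ∘ x) _ ?_).symm
  intro x _ y _
  rw [strongPow_pullbackGraph, pullbackGraph_compl_adj]

lemma HasRefinement.le_of_compl_le {f : SpectralPoint.{u}} {H K : SimpleGraph X} {P : X → ℝ}
    (hP : P ∈ stdSimplex ℝ X) (hHK : ∀ x y, Hᶜ.Adj x y → Kᶜ.Adj x y) {L L' : ℝ}
    (hL : HasRefinement f H P L) (hL' : HasRefinement f K P L') : L ≤ L' := by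
  obtain ⟨Q, hQ, hlim⟩ := exists_isNType_tendsto hP
  refine le_of_tendsto_of_tendsto' (hL Q hQ hlim) (hL' Q hQ hlim) fun n => ?_
  obtain ⟨c, hc, hcn⟩ := (hQ n).exists_count
  refine mul_le_mul_of_nonneg_left ?_ (by positivity)
  change Real.logb 2 (f.on (strongPow H n) (typeClass n (Q n))) ≤
    Real.logb 2 (f.on (strongPow K n) (typeClass n (Q n)))
  rw [typeClass_eq_countClass hc]
  refine Real.logb_le_logb_of_le one_lt_two
    (f.on_pos (H := strongPow H n) (countClass_nonempty (by simp [hcn]))) ?_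
  refine f.on_le_on (H := strongPow H n) (K := strongPow K n) id (fun _ h => h) ?_
  intro x _ y _ h
  rw [strongPow_eq_powGraph, powGraph_compl_adj] at h ⊢
  obtain ⟨i, hi⟩ := h
  exact ⟨i, hHK _ _ hi⟩

end Pullback

/-! ### Least value of a set of given weight -/

section MinLog

variable {X Y : Type u} [Fintype X] [Fintype Y]

/-- The total weight of a set. -/
noncomputable def mass (ν : X → ℝ) (S : Set X) : ℝ := ∑ x, S.indicator ν x

lemma mass_mono {ν : X → ℝ} (hν : 0 ≤ ν) {S T : Set X} (h : S ⊆ T) : mass ν S ≤ mass ν T :=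
  Finset.sum_le_sum fun x _ => Set.indicator_le_indicator_of_subset h hν x

lemma mass_univ (ν : X → ℝ) : mass ν Set.univ = ∑ x, ν x := by simp [mass]

lemma mass_empty (ν : X → ℝ) : mass ν ∅ = 0 := by simp [mass]

lemma mass_pushWeight [DecidableEq Y] (φ : X → Y) (ν : X → ℝ) (T : Set Y) :
    mass (pushWeight φ ν) T = mass ν (φ ⁻¹' T) := by
  classical
  have h := sum_pushWeight φ ν (T.indicator 1)
  simp only [Set.indicator_apply, Pi.one_apply, mul_ite, mul_one, mul_zero] at h
  simpa only [mass, Set.indicator_apply, Set.mem_preimage] using h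

/-- The least binary logarithm of the value of `f` on a set of weight at least `c`. -/
noncomputable def SpectralPoint.minLog (f : SpectralPoint.{u}) (H : SimpleGraph X) (ν : X → ℝ)
    (c : ℝ) : ℝ :=
  ⨅ S : {S : Set X // c ≤ mass ν S}, Real.logb 2 (f.on H S.1)

variable (f : SpectralPoint.{u}) (H : SimpleGraph X)

lemma SpectralPoint.minLog_le {ν : X → ℝ} {c : ℝ} {S : Set X} (h : c ≤ mass ν S) :
    f.minLog H ν c ≤ Real.logb 2 (f.on H S) :=
  ciInf_le (f := fun S : {S : Set X // c ≤ mass ν S} => Real.logb 2 (f.on H S.1))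
    (Set.finite_range _).bddBelow ⟨S, h⟩

lemma SpectralPoint.le_minLog {ν : X → ℝ} {c b : ℝ} (hc0 : 0 < c) (hc : c ≤ ∑ x, ν x)
    (h : ∀ S : Set X, S.Nonempty → c ≤ mass ν S → b ≤ Real.logb 2 (f.on H S)) :
    b ≤ f.minLog H ν c := by
  have : Nonempty {S : Set X // c ≤ mass ν S} := ⟨⟨Set.univ, by rwa [mass_univ]⟩⟩
  refine le_ciInf fun S => h S.1 ?_ S.2
  rw [Set.nonempty_iff_ne_empty]
  intro h0
  have := S.2
  rw [h0, mass_empty] at this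
  linarith

/-- A set of words over the pullback graph and its image are worth the same, and passing to the full
preimage of the image does not lower the weight. -/
lemma SpectralPoint.minLog_pullback [DecidableEq Y] (φ : X → Y) (K : SimpleGraph Y) {ν : X → ℝ}
    (hν : ν ∈ stdSimplex ℝ X) {c : ℝ} (hc0 : 0 < c) (hc1 : c ≤ 1) :
    f.minLog (pullbackGraph φ K) ν c = f.minLog K (pushWeight φ ν) c := by
  apply le_antisymm
  · refine f.le_minLog _ hc0 (by rwa [(pushWeight_mem_stdSimplex φ hν).2]) fun S _ hcS => ?_
    rw [mass_pushWeight] at hcS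
    refine (f.minLog_le _ hcS).trans ?_
    have hne : (φ ⁻¹' S).Nonempty := by
      rw [Set.nonempty_iff_ne_empty]
      intro h0
      rw [h0, mass_empty] at hcS
      linarith
    refine Real.logb_le_logb_of_le one_lt_two (f.on_pos hne) ?_
    exact f.on_le_on φ (fun x hx => hx) fun x _ y _ => pullbackGraph_compl_adj.1
  · refine f.le_minLog _ hc0 (by rwa [hν.2]) fun S _ hcS => ?_
    rw [← f.on_image (K := K) φ S fun x _ y _ => pullbackGraph_compl_adj]
    apply f.minLog_le
    rw [mass_pushWeight]
    exact hcS.trans (mass_mono hν.1 (Set.subset_preimage_image φ S))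

end MinLog

/-! ### Marginals of a source -/

section Marginals

lemma measurable_restrict_fin {V : Type u} [MeasurableSpace V] (n : ℕ) :
    Measurable fun (x : ℕ → V) (i : Fin n) => x i :=
  measurable_pi_lambda _ fun _ => measurable_pi_apply _

variable {V Z : Type u} [Fintype V] [MeasurableSpace V] [DiscreteMeasurableSpace V]
  [Fintype Z] [MeasurableSpace Z] [DiscreteMeasurableSpace Z]

lemma measureReal_restrict_eq_mass (μ : Measure (ℕ → V)) [IsProbabilityMeasure μ] (n : ℕ)
    (S : Set (Fin n → V)) :
    μ.real {x | (fun i : Fin n => x i) ∈ S} = mass (marginal μ n) S := by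
  classical
  have h1 : {x : ℕ → V | (fun i : Fin n => x i) ∈ S} =
      ⋃ w ∈ S.toFinset, {x | (fun i : Fin n => x i) = w} := by
    ext x
    simp
  rw [h1, measureReal_biUnion_finset]
  · unfold mass
    rw [← Finset.sum_indicator_subset _ (Finset.subset_univ S.toFinset)]
    refine Finset.sum_congr rfl fun w _ => ?_
    rw [Set.coe_toFinset]
    rfl
  · intro w _ w' _ hne
    rw [Function.onFun, Set.disjoint_left]
    intro x hx hx'
    exact hne (Eq.trans (Eq.symm hx) hx')
  · intro w _
    exact measurable_restrict_fin n (measurableSet_singleton w)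

lemma marginal_mem_stdSimplex (μ : Measure (ℕ → V)) [IsProbabilityMeasure μ] (n : ℕ) :
    marginal μ n ∈ stdSimplex ℝ (Fin n → V) := by
  refine ⟨fun w => measureReal_nonneg, ?_⟩
  rw [← mass_univ, ← measureReal_restrict_eq_mass]
  simp

lemma minLogRate_eq (f : SpectralPoint.{u}) (G : SimpleGraph V) (μ : Measure (ℕ → V))
    [IsProbabilityMeasure μ] (c : ℝ) (n : ℕ) :
    minLogRate f G μ c n = 1 / (n : ℝ) * f.minLog (strongPow G n) (marginal μ n) c := by
  unfold minLogRate SpectralPoint.minLog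
  rw [Real.mul_iInf_of_nonneg (by positivity)]
  exact Equiv.iInf_congr (Equiv.subtypeEquivRight fun S => by
    rw [measureReal_restrict_eq_mass]) fun S => rfl

lemma marginal_map [DecidableEq V] (φ : Z → V) (μ : Measure (ℕ → Z)) [IsProbabilityMeasure μ]
    (n : ℕ) : marginal (μ.map fun z i => φ (z i)) n =
      pushWeight (fun x : Fin n → Z => φ ∘ x) (marginal μ n) := by
  ext w
  have hm : Measurable fun (z : ℕ → Z) (i : ℕ) => φ (z i) :=
    measurable_pi_lambda _ fun i => (measurable_of_finite φ).comp (measurable_pi_apply _)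
  have h1 : marginal (μ.map fun z i => φ (z i)) n w =
      μ.real {x | (fun i : Fin n => x i) ∈ (fun x : Fin n → Z => φ ∘ x) ⁻¹' {w}} := by
    unfold marginal
    exact map_measureReal_apply hm (measurable_restrict_fin n (measurableSet_singleton w))
  classical
  rw [h1, measureReal_restrict_eq_mass]
  refine Finset.sum_congr rfl fun x _ => ?_
  rw [Set.indicator_apply]
  exact if_congr Iff.rfl rfl rfl

lemma marginal_eq_pushWeight_castLE [DecidableEq V] (μ : Measure (ℕ → V)) [IsProbabilityMeasure μ] (m n : ℕ)
    (h : m ≤ n) : marginal μ m =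
      pushWeight (fun (x : Fin n → V) i => x (Fin.castLE h i)) (marginal μ n) := by
  ext w
  have h1 : marginal μ m w = μ.real {x | (fun i : Fin n => x i) ∈
      (fun (x : Fin n → V) i => x (Fin.castLE h i)) ⁻¹' {w}} := rfl
  classical
  rw [h1, measureReal_restrict_eq_mass]
  refine Finset.sum_congr rfl fun x _ => ?_
  rw [Set.indicator_apply]
  exact if_congr Iff.rfl rfl rfl

end Marginals

/-! ### Stationary Markov chains -/

section Chain

variable {A : Type u} [Fintype A]

/-- `q` is a stationary distribution of the stochastic matrix `U`, which is irreducible on the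
support of `q`. -/
structure IsStationaryChain (q : A → ℝ) (U : A → A → ℝ) : Prop where
  init : q ∈ stdSimplex ℝ A
  row : ∀ a, U a ∈ stdSimplex ℝ A
  stat : ∀ b, ∑ a, q a * U a b = q b
  irred : ∀ a b, 0 < q a → 0 < q b → Relation.ReflTransGen (fun s t => 0 < U s t) a b

/-- The probability of the word `w` under the Markov chain with initial law `q` and transition
matrix `U`. -/
def chainWeight {A : Type u} (q : A → ℝ) (U : A → A → ℝ) (m : ℕ) (w : Fin (m + 1) → A) : ℝ :=
  q (w 0) * ∏ i : Fin m, U (w i.castSucc) (w i.succ)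

variable {q : A → ℝ} {U : A → A → ℝ}

lemma IsStationaryChain.pos_of_pos (h : IsStationaryChain q U) {a b : A} (ha : 0 < q a) (hab : 0 < U a b) : 0 < q b := by
  rw [← h.stat b]
  exact (mul_pos ha hab).trans_le (Finset.single_le_sum (f := fun a => q a * U a b)
    (fun a _ => mul_nonneg (h.init.1 a) ((h.row a).1 b)) (Finset.mem_univ a))

/-- A stationary distribution supported in the support of `q` equals `q`: the least ratio of the
two laws is attained at some letter, and irreducibility spreads the equality from there to the whole
support. -/
lemma IsStationaryChain.eq_of_stationary (h : IsStationaryChain q U) {π : A → ℝ} (hπ : π ∈ stdSimplex ℝ A)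
    (hsupp : ∀ a, q a = 0 → π a = 0) (hstat : ∀ b, ∑ a, π a * U a b = π b) : π = q := by
  classical
  have hq0 : ∀ a, 0 ≤ q a := h.init.1
  obtain ⟨a₁, ha₁⟩ : ∃ a, 0 < q a := by
    by_contra! hcon
    have : ∑ a, q a ≤ 0 := Finset.sum_nonpos fun a _ => hcon a
    rw [h.init.2] at this
    linarith
  obtain ⟨b, hb, hmin⟩ := (Finset.univ.filter fun a => 0 < q a).exists_min_image
    (fun a => π a / q a) ⟨a₁, by simpa using ha₁⟩
  simp only [Finset.mem_filter, Finset.mem_univ, true_and] at hb hmin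
  set l := π b / q b with hl
  let ν : A → ℝ := fun a => π a - l * q a
  have hν0 : ∀ a, 0 ≤ ν a := by
    intro a
    rcases (hq0 a).eq_or_lt with ha | ha
    · simp [ν, ← ha, hsupp a ha.symm]
    · have := hmin a ha
      rw [le_div_iff₀ ha] at this
      simpa [ν] using this
  have hνstat : ∀ c, ∑ a, ν a * U a c = ν c := by
    intro c
    simp only [ν, sub_mul, Finset.sum_sub_distrib, hstat, mul_assoc, ← Finset.mul_sum, h.stat]
  have hνb : ν b = 0 := by simp [ν, hl, hb.ne']
  have hback : ∀ s t, 0 < U s t → ν t = 0 → ν s = 0 := by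
    intro s t hst ht
    rw [← hνstat t, Finset.sum_eq_zero_iff_of_nonneg
      fun a _ => mul_nonneg (hν0 a) ((h.row a).1 t)] at ht
    exact (mul_eq_zero.1 (ht s (Finset.mem_univ s))).resolve_right hst.ne'
  have hzero : ∀ a, ν a = 0 := by
    intro a
    rcases (hq0 a).eq_or_lt with ha | ha
    · simp [ν, ← ha, hsupp a ha.symm]
    · refine Relation.ReflTransGen.head_induction_on (motive := fun s _ => ν s = 0)
        (h.irred a b ha hb) hνb ?_
      intro s t hst _ ht
      exact hback s t hst ht
  have hl1 : l = 1 := by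
    have : ∑ a, ν a = 0 := Finset.sum_eq_zero fun a _ => hzero a
    simp only [ν, Finset.sum_sub_distrib, ← Finset.mul_sum, hπ.2, h.init.2] at this
    linarith
  ext a
  have := hzero a
  simp only [ν, hl1] at this
  linarith

/-- Almost stationary distributions are close to the stationary one, by compactness. -/
lemma IsStationaryChain.near_of_almost_stationary (h : IsStationaryChain q U) {ε : ℝ} (hε : 0 < ε) :
    ∃ η > 0, ∀ π ∈ stdSimplex ℝ A, (∀ a, q a = 0 → π a = 0) →
      (∀ b, |π b - ∑ a, π a * U a b| ≤ η) → ∀ a, |π a - q a| ≤ ε := by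
  classical
  let K : Set (A → ℝ) := stdSimplex ℝ A ∩
    ((⋂ a, ⋂ _ : q a = 0, {π | π a = 0}) ∩ {π | ε ≤ ‖π - q‖})
  have hKmem : ∀ π, π ∈ K ↔ π ∈ stdSimplex ℝ A ∧ (∀ a, q a = 0 → π a = 0) ∧ ε ≤ ‖π - q‖ := by
    intro π
    simp [K]
  let Φ : (A → ℝ) → ℝ := fun π => ∑ b, |π b - ∑ a, π a * U a b|
  have hΦ : Continuous Φ := by fun_prop
  have hK : IsCompact K := by
    refine (isCompact_stdSimplex ℝ A).inter_right (IsClosed.inter ?_ ?_)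
    · refine isClosed_iInter fun a => isClosed_iInter fun _ => ?_
      exact isClosed_eq (continuous_apply a) continuous_const
    · exact isClosed_le continuous_const ((continuous_id.sub continuous_const).norm)
  have hgoal : ∀ π : A → ℝ, ‖π - q‖ < ε → ∀ a, |π a - q a| ≤ ε := fun π hπ a =>
    (norm_le_pi_norm (π - q) a).trans hπ.le
  rcases K.eq_empty_or_nonempty with hK0 | hKne
  · refine ⟨1, one_pos, fun π hπ hs _ => hgoal π ?_⟩
    by_contra! hcon
    exact (Set.eq_empty_iff_forall_notMem.1 hK0 π) ((hKmem π).2 ⟨hπ, hs, hcon⟩)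
  · obtain ⟨π₀, hπ₀, hmin⟩ := hK.exists_isMinOn hKne hΦ.continuousOn
    have hπ₀' := (hKmem π₀).1 hπ₀
    have hpos : 0 < Φ π₀ := by
      refine lt_of_le_of_ne (Finset.sum_nonneg fun b _ => abs_nonneg _) fun h0 => ?_
      have h1 := (Finset.sum_eq_zero_iff_of_nonneg fun b _ => abs_nonneg _).1 h0.symm
      have h2 : π₀ = q := h.eq_of_stationary hπ₀'.1 hπ₀'.2.1 fun b => by
        have := h1 b (Finset.mem_univ b)
        rw [abs_eq_zero] at this
        linarith
      have h3 := hπ₀'.2.2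
      rw [h2, sub_self, norm_zero] at h3
      linarith
    refine ⟨Φ π₀ / (Fintype.card A + 1), by positivity, fun π hπ hs hη => hgoal π ?_⟩
    by_contra! hcon
    have h1 : Φ π₀ ≤ Φ π := hmin ((hKmem π).2 ⟨hπ, hs, hcon⟩)
    have h2 : Φ π ≤ Fintype.card A * (Φ π₀ / (Fintype.card A + 1)) := by
      refine (Finset.sum_le_sum fun b _ => hη b).trans ?_
      rw [Finset.sum_const, Finset.card_univ, nsmul_eq_mul]
    have h3 : Fintype.card A * (Φ π₀ / (Fintype.card A + 1)) < Φ π₀ := by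
      rw [mul_div_assoc', div_lt_iff₀ (by positivity)]
      nlinarith
    linarith

lemma chainWeight_snoc {A : Type u} {q : A → ℝ} {U : A → A → ℝ} (m : ℕ) (w : Fin (m + 1) → A) (v : A) :
    chainWeight q U (m + 1) (Fin.snoc w v : Fin (m + 2) → A) =
      chainWeight q U m w * U (w (Fin.last m)) v := by
  unfold chainWeight
  rw [Fin.prod_univ_castSucc]
  have h0 : (Fin.snoc w v : Fin (m + 2) → A) 0 = w 0 := by
    rw [← Fin.castSucc_zero, Fin.snoc_castSucc (α := fun _ => A)]
  simp only [h0, ← Fin.castSucc_succ, Fin.snoc_castSucc (α := fun _ => A), Fin.succ_last,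
    Fin.snoc_last (α := fun _ => A)]
  ring

lemma sum_snoc (m : ℕ) (g : (Fin (m + 1) → A) → ℝ) :
    ∑ x, g x = ∑ w : Fin m → A, ∑ v, g (Fin.snoc w v : Fin (m + 1) → A) := by
  rw [← (Fin.snocEquiv fun _ => A).sum_comp, Fintype.sum_prod_type, Finset.sum_comm]
  rfl

lemma chainWeight_mem_stdSimplex_of_row (hq : q ∈ stdSimplex ℝ A)
    (hU : ∀ a, U a ∈ stdSimplex ℝ A) (m : ℕ) :
    chainWeight q U m ∈ stdSimplex ℝ (Fin (m + 1) → A) := by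
  refine ⟨fun w => mul_nonneg (hq.1 _) (Finset.prod_nonneg fun _ _ => (hU _).1 _), ?_⟩
  induction m with
  | zero =>
    rw [← hq.2, ← (Equiv.funUnique (Fin 1) A).sum_comp]
    simp [chainWeight]
  | succ m ih =>
    rw [sum_snoc]
    simp only [chainWeight_snoc, ← Finset.mul_sum, (hU _).2, mul_one, ih]

lemma chainWeight_mem_stdSimplex (h : IsStationaryChain q U) (m : ℕ) :
    chainWeight q U m ∈ stdSimplex ℝ (Fin (m + 1) → A) :=
  chainWeight_mem_stdSimplex_of_row h.init h.row m

lemma chainWeight_nonneg (h : IsStationaryChain q U) (m : ℕ) (w : Fin (m + 1) → A) :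
    0 ≤ chainWeight q U m w := (chainWeight_mem_stdSimplex h m).1 w

lemma chainWeight_sum (h : IsStationaryChain q U) (m : ℕ) : ∑ w, chainWeight q U m w = 1 :=
  (chainWeight_mem_stdSimplex h m).2

lemma pos_of_chainWeight_ne_zero (h : IsStationaryChain q U) {m : ℕ} {w : Fin (m + 1) → A} (hw : chainWeight q U m w ≠ 0)
    (i : Fin (m + 1)) : 0 < q (w i) := by
  unfold chainWeight at hw
  rw [mul_ne_zero_iff, Finset.prod_ne_zero_iff] at hw
  induction i using Fin.induction with
  | zero => exact (h.init.1 _).lt_of_ne' hw.1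
  | succ i ih => exact h.pos_of_pos ih (((h.row _).1 _).lt_of_ne' (hw.2 i (Finset.mem_univ i)))

/-- The martingale that compensates the number of visits to `u` by the transition probabilities into
`u`. -/
noncomputable def visitMartingale {A : Type u} [DecidableEq A] (U : A → A → ℝ) (u : A) (m : ℕ)
    (w : Fin (m + 1) → A) : ℝ :=
  ∑ i : Fin m, ((if w i.succ = u then 1 else 0) - U (w i.castSucc) u)

lemma visitMartingale_snoc {A : Type u} {U : A → A → ℝ} [DecidableEq A] (u : A) (m : ℕ) (w : Fin (m + 1) → A) (v : A) :
    visitMartingale U u (m + 1) (Fin.snoc w v : Fin (m + 2) → A) =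
      visitMartingale U u m w + ((if v = u then 1 else 0) - U (w (Fin.last m)) u) := by
  unfold visitMartingale
  rw [Fin.sum_univ_castSucc]
  simp only [← Fin.castSucc_succ, Fin.snoc_castSucc (α := fun _ => A), Fin.succ_last,
    Fin.snoc_last (α := fun _ => A)]

/-- Orthogonality of the increments bounds the second moment by the number of steps. -/
lemma visitMartingale_sq_le [DecidableEq A] (h : IsStationaryChain q U) (u : A) (m : ℕ) :
    ∑ w, chainWeight q U m w * visitMartingale U u m w ^ 2 ≤ m := by
  induction m with
  | zero => simp [visitMartingale]
  | succ m ih =>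
    rw [sum_snoc]
    have step : ∀ w : Fin (m + 1) → A,
        ∑ v, chainWeight q U (m + 1) (Fin.snoc w v : Fin (m + 2) → A) *
          visitMartingale U u (m + 1) (Fin.snoc w v : Fin (m + 2) → A) ^ 2 ≤
        chainWeight q U m w * visitMartingale U u m w ^ 2 + chainWeight q U m w := by
      intro w
      set a := w (Fin.last m)
      have hrow := (h.row a).2
      have hu0 : 0 ≤ U a u := (h.row a).1 u
      have key : ∀ D : ℝ, ∑ v, U a v * (D + ((if v = u then 1 else 0) - U a u)) ^ 2 =
          D ^ 2 + U a u * (1 - U a u) := by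
        intro D
        have : ∀ v, U a v * (D + ((if v = u then 1 else 0) - U a u)) ^ 2 =
            (D - U a u) ^ 2 * U a v + if v = u then (2 * (D - U a u) + 1) * U a v else 0 := by
          intro v
          split_ifs <;> ring
        simp_rw [this]
        rw [Finset.sum_add_distrib, ← Finset.mul_sum, hrow, Finset.sum_ite_eq']
        simp only [Finset.mem_univ, if_true]
        ring
      simp_rw [chainWeight_snoc, visitMartingale_snoc, mul_assoc]
      rw [← Finset.mul_sum, key, mul_add]
      have hw := chainWeight_nonneg h m w
      have : U a u * (1 - U a u) ≤ 1 := by nlinarith [sq_nonneg (U a u - 1)]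
      nlinarith
    refine (Finset.sum_le_sum fun w _ => step w).trans ?_
    rw [Finset.sum_add_distrib, chainWeight_sum h]
    push_cast
    linarith

lemma mass_le_of_sq_le {X : Type u} [Fintype X] {ν g : X → ℝ} (hν : 0 ≤ ν) {t B : ℝ} (ht : 0 < t)
    (hB : ∑ x, ν x * g x ^ 2 ≤ B) : mass ν {x | t < |g x|} ≤ B / t ^ 2 := by
  classical
  rw [le_div_iff₀ (by positivity)]
  refine le_trans ?_ hB
  rw [mass, Finset.sum_mul]
  refine Finset.sum_le_sum fun x _ => ?_
  rw [Set.indicator_apply]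
  split_ifs with hx
  · have : t ^ 2 ≤ g x ^ 2 := by
      rw [← sq_abs (g x)]
      have : t < |g x| := hx
      gcongr
    exact mul_le_mul_of_nonneg_left this (hν x)
  · rw [zero_mul]
    exact mul_nonneg (hν x) (sq_nonneg _)

end Chain

/-! ### The law of large numbers for letter frequencies -/

section TypicalWords

/-- The number of occurrences of each letter in the word `w`. -/
noncomputable def letterCount {A : Type u} {I : Type} (w : I → A) (a : A) : ℕ :=
  Nat.card {i // w i = a}

lemma mem_countClass_letterCount {A : Type u} {I : Type} (w : I → A) :
    w ∈ countClass I (letterCount w) := fun _ => rfl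

/-- The words of length `n` whose letter frequencies differ from `q` by at most `δ`. -/
def typicalSet {A : Type u} (q : A → ℝ) (δ : ℝ) (n : ℕ) : Set (Fin n → A) :=
  {w | ∀ a, |(letterCount w a : ℝ) - n * q a| ≤ δ * n}

variable {A : Type u} [Fintype A] {q : A → ℝ} {U : A → A → ℝ}

lemma sum_letterCount {n : ℕ} (w : Fin n → A) : ∑ a, letterCount w a = n := by
  rw [← card_eq_of_mem_countClass (mem_countClass_letterCount w)]
  simp

lemma letterCount_eq_sum {A : Type u} [DecidableEq A] {n : ℕ} (w : Fin n → A) (a : A) :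
    (letterCount w a : ℝ) = ∑ i, if w i = a then 1 else 0 := by
  rw [letterCount, Nat.card_eq_fintype_card, Fintype.card_subtype, Finset.sum_boole]

lemma sum_letterCount_mul {n : ℕ} (w : Fin n → A) (g : A → ℝ) :
    ∑ a, (letterCount w a : ℝ) * g a = ∑ i, g (w i) := by
  classical
  simp only [letterCount_eq_sum, Finset.sum_mul, ite_mul, one_mul, zero_mul]
  rw [Finset.sum_comm]
  simp

lemma mass_compl {X : Type u} [Fintype X] (ν : X → ℝ) (S : Set X) :
    mass ν S + mass ν Sᶜ = ∑ x, ν x := by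
  rw [mass, mass, ← Finset.sum_add_distrib]
  exact Finset.sum_congr rfl fun x _ => congrFun (Set.indicator_self_add_compl S ν) x

/-- The defect of stationarity of the letter frequencies is controlled by `visitMartingale`. -/
lemma abs_letterCount_sub_le [DecidableEq A] (h : IsStationaryChain q U) (u : A) {m : ℕ}
    (w : Fin (m + 1) → A) :
    |(letterCount w u : ℝ) - ∑ a, (letterCount w a : ℝ) * U a u| ≤
      |visitMartingale U u m w| + 1 := by
  have hU1 : ∀ a, U a u ≤ 1 := fun a => by
    rw [← (h.row a).2]
    exact Finset.single_le_sum (fun b _ => (h.row a).1 b) (Finset.mem_univ u)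
  have hU0 : ∀ a, 0 ≤ U a u := fun a => (h.row a).1 u
  rw [sum_letterCount_mul, letterCount_eq_sum, Fin.sum_univ_succ,
    Fin.sum_univ_castSucc (f := fun i => U (w i) u)]
  have hD : visitMartingale U u m w = ∑ i : Fin m, (if w i.succ = u then (1 : ℝ) else 0) -
      ∑ i : Fin m, U (w i.castSucc) u := by
    rw [visitMartingale, Finset.sum_sub_distrib]
  have e : (if w 0 = u then (1 : ℝ) else 0) + ∑ i : Fin m, (if w i.succ = u then (1 : ℝ) else 0) -
      (∑ i : Fin m, U (w i.castSucc) u + U (w (Fin.last m)) u) = visitMartingale U u m w +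
        ((if w 0 = u then (1 : ℝ) else 0) - U (w (Fin.last m)) u) := by
    rw [hD]
    ring
  rw [e]
  refine (abs_add_le _ _).trans (add_le_add_right ?_ _)
  rw [abs_le]
  have h0 := hU0 (w (Fin.last m))
  have h1 := hU1 (w (Fin.last m))
  split_ifs <;> constructor <;> linarith

/-- Weak law of large numbers for the letter frequencies of a stationary Markov chain. -/
lemma IsStationaryChain.eventually_mass_compl_typicalSet_le (h : IsStationaryChain q U) {δ η : ℝ}
    (hδ : 0 < δ) (hη : 0 < η) :
    ∀ᶠ m : ℕ in atTop, mass (chainWeight q U m) (typicalSet q δ (m + 1))ᶜ ≤ η := by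
  classical
  obtain ⟨r, hr, hnear⟩ := h.near_of_almost_stationary hδ
  have hlim : Tendsto (fun m : ℕ => 4 * (Fintype.card A : ℝ) / r ^ 2 / ((m : ℝ) + 1)) atTop (𝓝 0) :=
    tendsto_const_nhds.div_atTop (tendsto_atTop_add_const_right _ _ tendsto_natCast_atTop_atTop)
  filter_upwards [hlim.eventually (gt_mem_nhds hη),
    tendsto_natCast_atTop_atTop.eventually_ge_atTop (2 / r)] with m hm1 hm2
  have hm0 : (0 : ℝ) < (m : ℝ) + 1 := by positivity
  set t : ℝ := r * (m + 1) / 2 with ht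
  have ht0 : 0 < t := by positivity
  have ht1 : 1 ≤ t := by
    rw [div_le_iff₀ hr] at hm2
    rw [ht]
    linarith
  have hbad : ∀ w : Fin (m + 1) → A, chainWeight q U m w ≠ 0 → w ∉ typicalSet q δ (m + 1) →
      ∃ u, t < |visitMartingale U u m w| := by
    intro w hw hnot
    by_contra! hcon
    refine hnot fun a => ?_
    let π : A → ℝ := fun a => letterCount w a / ((m : ℝ) + 1)
    have hπsum : ∑ a, π a = 1 := by
      simp only [π, ← Finset.sum_div]
      rw [div_eq_one_iff_eq hm0.ne']
      exact_mod_cast sum_letterCount w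
    have hπ := hnear π ⟨fun a => by positivity, hπsum⟩ (fun a ha => by
        have : letterCount w a = 0 := by
          rw [letterCount, Nat.card_eq_zero]
          refine Or.inl ⟨?_⟩
          rintro ⟨i, rfl⟩
          exact (pos_of_chainWeight_ne_zero h hw i).ne' ha
        simp [π, this]) (fun b => by
        have h1 := (abs_letterCount_sub_le h b w).trans (add_le_add_left (hcon b) 1)
        have h2 : π b - ∑ a, π a * U a b =
            (letterCount w b - ∑ a, (letterCount w a : ℝ) * U a b) / ((m : ℝ) + 1) := by
          simp only [π, sub_div, Finset.sum_div]
          congr 1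
          exact Finset.sum_congr rfl fun a _ => by ring
        rw [h2, abs_div, abs_of_pos hm0, div_le_iff₀ hm0]
        linarith) a
    have h3 : (letterCount w a : ℝ) - (m + 1 : ℕ) * q a = (π a - q a) * ((m : ℝ) + 1) := by
      simp only [π]
      push_cast
      field_simp
    rw [h3, abs_mul, abs_of_pos hm0]
    push_cast
    gcongr
  have hle : mass (chainWeight q U m) (typicalSet q δ (m + 1))ᶜ ≤
      ∑ u, mass (chainWeight q U m) {w | t < |visitMartingale U u m w|} := by
    simp only [mass]
    rw [Finset.sum_comm]
    refine Finset.sum_le_sum fun w _ => ?_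
    have hnn : ∀ S : Set (Fin (m + 1) → A), 0 ≤ S.indicator (chainWeight q U m) w := fun S =>
      Set.indicator_nonneg (fun _ _ => chainWeight_nonneg h m _) w
    by_cases hw : w ∈ (typicalSet q δ (m + 1))ᶜ ∧ chainWeight q U m w ≠ 0
    · obtain ⟨u, hu⟩ := hbad w hw.2 hw.1
      rw [Set.indicator_of_mem hw.1]
      refine le_trans ?_ (Finset.single_le_sum (fun u _ => hnn _) (Finset.mem_univ u))
      rw [Set.indicator_of_mem (by exact hu)]
    · have : (typicalSet q δ (m + 1))ᶜ.indicator (chainWeight q U m) w = 0 := by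
        rw [Set.indicator_apply]
        split_ifs with h1
        · exact not_not.1 fun h2 => hw ⟨h1, h2⟩
        · rfl
      rw [this]
      exact Finset.sum_nonneg fun u _ => hnn _
  refine hle.trans ((Finset.sum_le_sum fun u _ => mass_le_of_sq_le (fun w => chainWeight_nonneg h m w)
    ht0 (visitMartingale_sq_le h u m)).trans (le_trans ?_ hm1.le))
  rw [Finset.sum_const, Finset.card_univ, nsmul_eq_mul, ht, div_pow, mul_pow, mul_div_assoc',
    div_div, div_le_div_iff₀ (by positivity) (by positivity)]
  have hmm : (m : ℝ) ≤ m + 1 := by linarith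
  have hA : (0 : ℝ) ≤ Fintype.card A := by positivity
  have : (Fintype.card A : ℝ) * m * (r ^ 2 * (m + 1)) ≤
      (Fintype.card A : ℝ) * (m + 1) * (r ^ 2 * (m + 1)) := by gcongr
  calc _ ≤ (Fintype.card A : ℝ) * (m + 1) * (r ^ 2 * (m + 1)) := this
    _ = _ := by ring

end TypicalWords

/-! ### Bounds for a chain with bounded density against its one-letter law -/

section AEPBounds

lemma eventually_log_le (K₁ K₂ : ℝ) {ε : ℝ} (hε : 0 < ε) :
    ∀ᶠ n : ℕ in atTop, K₁ + K₂ * Real.logb 2 (n + 1) ≤ ε * n := by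
  have h1 : Tendsto (fun n : ℕ => Real.logb 2 ((n : ℝ) + 1) / ((n : ℝ) + 1)) atTop (𝓝 0) := by
    have h2 := (Real.isLittleO_log_id_atTop.tendsto_div_nhds_zero).comp
      (tendsto_atTop_add_const_right atTop (1 : ℝ) (tendsto_natCast_atTop_atTop (R := ℝ)))
    have h3 := h2.div_const (Real.log 2)
    rw [zero_div] at h3
    refine h3.congr fun n => ?_
    simp only [Function.comp_apply, id, Real.logb]
    ring
  have h4 : Tendsto (fun n : ℕ => (1 : ℝ) / ((n : ℝ) + 1)) atTop (𝓝 0) :=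
    tendsto_one_div_add_atTop_nhds_zero_nat
  have h5 := (h4.const_mul (K₁ + ε)).add (h1.const_mul K₂)
  simp only [mul_zero, add_zero] at h5
  filter_upwards [h5.eventually (gt_mem_nhds hε)] with n hn
  have hn0 : (0 : ℝ) < (n : ℝ) + 1 := by positivity
  have h6 : (K₁ + ε) * (1 / ((n : ℝ) + 1)) + K₂ * (Real.logb 2 ((n : ℝ) + 1) / ((n : ℝ) + 1)) =
      (K₁ + ε + K₂ * Real.logb 2 ((n : ℝ) + 1)) / ((n : ℝ) + 1) := by ring
  rw [h6, div_lt_iff₀ hn0] at hn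
  linarith

variable {A : Type u} [Fintype A] {q : A → ℝ} {U : A → A → ℝ}

/-- The letter counts of the typical words. -/
noncomputable def typicalCounts (q : A → ℝ) (δ : ℝ) (n : ℕ) : Finset (A → ℕ) :=
  (Set.toFinite (letterCount '' typicalSet q δ n)).toFinset

lemma mem_typicalCounts {δ : ℝ} {n : ℕ} {c : A → ℕ} :
    c ∈ typicalCounts q δ n ↔ ∃ w ∈ typicalSet q δ n, letterCount w = c := by
  simp [typicalCounts]

/-- There are only polynomially many types. -/
lemma card_typicalCounts_le (δ : ℝ) (n : ℕ) :
    (typicalCounts q δ n).card ≤ (n + 1) ^ Fintype.card A := by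
  classical
  have : typicalCounts q δ n ⊆ Fintype.piFinset fun _ => Finset.range (n + 1) := by
    intro c hc
    obtain ⟨w, -, rfl⟩ := mem_typicalCounts.1 hc
    rw [Fintype.mem_piFinset]
    intro a
    rw [Finset.mem_range, Nat.lt_succ_iff]
    conv_rhs => rw [← sum_letterCount w]
    exact Finset.single_le_sum (fun a _ => Nat.zero_le _) (Finset.mem_univ a)
  refine (Finset.card_le_card this).trans ?_
  simp

lemma typicalSet_subset_biUnion (δ : ℝ) (n : ℕ) :
    typicalSet q δ n ⊆ ⋃ c ∈ typicalCounts q δ n, countClass (Fin n) c := fun w hw =>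
  Set.mem_biUnion (mem_typicalCounts.2 ⟨w, hw, rfl⟩) (mem_countClass_letterCount w)

variable {f : SpectralPoint.{u}} {H : SimpleGraph A} {L : ℝ}

lemma SpectralPoint.IsUniformRefinement.exists_typicalCounts
    (hL : f.IsUniformRefinement H q L) {ε : ℝ} (hε : 0 < ε) :
    ∃ δ > 0, ∀ᶠ n : ℕ in atTop, ∀ c ∈ typicalCounts q δ n, ∑ a, c a = n ∧
      |f.logCount H c - n * L| ≤ ε * n := by
  obtain ⟨δ, hδ, N, hN⟩ := hL ε hε
  refine ⟨δ, hδ, eventually_atTop.2 ⟨N, fun n hn c hc => ?_⟩⟩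
  obtain ⟨w, hw, rfl⟩ := mem_typicalCounts.1 hc
  exact ⟨sum_letterCount w, hN n hn _ (sum_letterCount w) hw⟩

/-- The typical words form polynomially many type classes, each of value about `2 ^ (n L)`. -/
lemma IsStationaryChain.eventually_minLog_le (h : IsStationaryChain q U)
    (hL : f.IsUniformRefinement H q L) {ε c : ℝ} (hε : 0 < ε) (hc0 : 0 < c) (hc1 : c < 1) :
    ∀ᶠ m : ℕ in atTop,
      f.minLog (strongPow H (m + 1)) (chainWeight q U m) c ≤ (m + 1 : ℕ) * (L + ε) := by
  obtain ⟨δ, hδ, hev⟩ := hL.exists_typicalCounts (half_pos hε)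
  filter_upwards [(tendsto_add_atTop_nat 1).eventually hev,
    (tendsto_add_atTop_nat 1).eventually (eventually_log_le 0 (Fintype.card A) (half_pos hε)),
    h.eventually_mass_compl_typicalSet_le hδ (sub_pos.2 hc1)] with m h1 h2 h3
  set n := m + 1 with hn
  have hmass : c ≤ mass (chainWeight q U m) (typicalSet q δ n) := by
    have := mass_compl (chainWeight q U m) (typicalSet q δ n)
    rw [chainWeight_sum h] at this
    linarith
  refine (f.minLog_le _ hmass).trans ?_
  have hval : ∀ d ∈ typicalCounts q δ n, f.on (strongPow H n) (countClass (Fin n) d) ≤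
      (2 : ℝ) ^ (n * (L + ε / 2)) := by
    intro d hd
    obtain ⟨hd1, hd2⟩ := h1 d hd
    have hne : (countClass (Fin n) d).Nonempty := countClass_nonempty (by simp [hd1])
    rw [← Real.logb_le_iff_le_rpow one_lt_two (f.on_pos hne), strongPow_eq_powGraph,
      f.logb_on_countClass H hd1]
    have := (abs_le.1 hd2).2
    linarith
  have hle : f.on (strongPow H n) (typicalSet q δ n) ≤
      ((n : ℝ) + 1) ^ Fintype.card A * (2 : ℝ) ^ (n * (L + ε / 2)) := by
    refine (f.on_mono (typicalSet_subset_biUnion δ n)).trans ((f.on_biUnion_le _ _ _).trans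
      ((Finset.sum_le_sum hval).trans ?_))
    rw [Finset.sum_const, nsmul_eq_mul]
    gcongr
    exact_mod_cast card_typicalCounts_le δ n
  have hne : (typicalSet q δ n).Nonempty := by
    rw [Set.nonempty_iff_ne_empty]
    intro he
    rw [he, mass_empty] at hmass
    linarith
  have := Real.logb_le_logb_of_le one_lt_two (f.on_pos hne) hle
  rw [Real.logb_mul (by positivity) (by positivity), Real.logb_pow,
    Real.logb_rpow two_pos (by norm_num)] at this
  linarith

/-- If `U a b ≤ C q b`, then the chain has density at most `C ^ m` with respect to the memoryless
source with letter distribution `q`. -/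
lemma chainWeight_le_iid (h : IsStationaryChain q U) {C : ℝ} (hC0 : 0 ≤ C)
    (hC : ∀ a b, 0 < q a → U a b ≤ C * q b) (m : ℕ) (w : Fin (m + 1) → A) :
    chainWeight q U m w ≤ C ^ m * ∏ i, q (w i) := by
  by_cases hw : chainWeight q U m w = 0
  · rw [hw]
    exact mul_nonneg (pow_nonneg hC0 m) (Finset.prod_nonneg fun i _ => h.init.1 _)
  · unfold chainWeight
    rw [Fin.prod_univ_succ]
    calc q (w 0) * ∏ i : Fin m, U (w i.castSucc) (w i.succ)
        ≤ q (w 0) * ∏ i : Fin m, (C * q (w i.succ)) := by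
          refine mul_le_mul_of_nonneg_left (Finset.prod_le_prod (fun i _ => (h.row _).1 _)
            fun i _ => hC _ _ (pos_of_chainWeight_ne_zero h hw _)) (h.init.1 _)
      _ = _ := by
        rw [Finset.prod_mul_distrib]
        simp only [Finset.prod_const, Finset.card_univ, Fintype.card_fin]
        ring

lemma prod_eq_of_mem_countClass {A : Type u} {q : A → ℝ} {n : ℕ} {d : A → ℕ} {x y : Fin n → A}
    (hx : x ∈ countClass (Fin n) d) (hy : y ∈ countClass (Fin n) d) :
    ∏ i, q (x i) = ∏ i, q (y i) := by
  obtain ⟨σ, rfl⟩ := exists_perm_of_mem_countClass hx hy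
  exact (Equiv.prod_comp σ fun i => q (x i)).symm

lemma sum_prod_eq_one (hq : q ∈ stdSimplex ℝ A) (n : ℕ) :
    ∑ w : Fin n → A, ∏ i, q (w i) = 1 := by
  classical
  rw [← Fintype.piFinset_univ, ← Finset.prod_univ_sum]
  simp [hq.2]

/-- A subset of a type class of proportion `1 / κ` has almost `1 / κ` of the value of the type class,
as the permutations of the coordinates act transitively. -/
lemma SpectralPoint.countVal_le_mul_on (f : SpectralPoint.{u}) (H : SimpleGraph A) {n : ℕ}
    {d : A → ℕ} (hd : ∑ a, d a = n) {S : Set (Fin n → A)} (hS : S ⊆ countClass (Fin n) d)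
    (hne : S.Nonempty) {κ : ℝ} (hκ : 1 ≤ κ)
    (hcard : (Nat.card (countClass (Fin n) d) : ℝ) ≤ κ * Nat.card S) :
    f.countVal H d ≤ κ * (n * Real.log (Fintype.card A) + 2) * f.on (strongPow H n) S := by
  classical
  let _ : MulAction (Equiv.Perm (Fin n)) (Fin n → A) := arrowAction
  have hact : ∀ (σ : Equiv.Perm (Fin n)) (x : Fin n → A), σ • x = x ∘ ⇑σ⁻¹ := fun _ _ => rfl
  have key := f.on_le_mul_of_transitive (Γ := Equiv.Perm (Fin n)) (strongPow H n) ?_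
    (countClass (Fin n) d).toFinset S.toFinset (by simpa using hS) ?_ ?_ κ hκ ?_ (by simpa using hne)
    (n * Real.log (Fintype.card A)) (by positivity) ?_
  · rw [Set.coe_toFinset, Set.coe_toFinset, strongPow_eq_powGraph,
      f.on_countClass H (by simp [hd])] at key
    exact key
  · intro σ x y hxy
    rw [strongPow_eq_powGraph, powGraph_compl_adj] at hxy ⊢
    obtain ⟨i, hi⟩ := hxy
    exact ⟨σ i, by simpa [hact] using hi⟩
  · intro x hx y hy
    rw [Set.mem_toFinset] at hx hy
    obtain ⟨σ, hσ⟩ := exists_perm_of_mem_countClass hx hy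
    exact ⟨σ⁻¹, by rw [hact, inv_inv, hσ]⟩
  · intro x hx σ
    rw [Set.mem_toFinset] at hx ⊢
    rw [hact]
    exact (comp_mem_countClass _).2 hx
  · simpa [Nat.card_eq_fintype_card] using hcard
  · have hA : 0 < Fintype.card A ∨ n = 0 := by
      rcases n.eq_zero_or_pos with h0 | h0
      · exact Or.inr h0
      · obtain ⟨x, -⟩ := hne
        exact Or.inl (Fintype.card_pos_iff.2 ⟨x ⟨0, h0⟩⟩)
    have h1 : (((countClass (Fin n) d).toFinset.card : ℕ) : ℝ) ≤ (Fintype.card A : ℝ) ^ n := by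
      exact_mod_cast (Finset.card_le_univ _).trans (by simp)
    refine h1.trans (le_of_eq ?_)
    rcases hA with hA | rfl
    · rw [Real.exp_nat_mul, Real.exp_log (by exact_mod_cast hA)]
    · simp

lemma mass_eq_card_mul {X : Type u} [Fintype X] {ν : X → ℝ} {x₀ : ℝ} (S : Set X)
    (hS : ∀ x ∈ S, ν x = x₀) : mass ν S = Nat.card S * x₀ := by
  classical
  have h1 : mass ν S = ∑ x ∈ S.toFinset, ν x := by
    rw [← Finset.sum_indicator_subset ν (Finset.subset_univ S.toFinset), Set.coe_toFinset]
    rfl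
  rw [h1, Finset.sum_congr rfl fun x hx => hS x (Set.mem_toFinset.1 hx), Finset.sum_const,
    nsmul_eq_mul, Set.toFinset_card, Nat.card_eq_fintype_card]

/-- A set of weight at least `c` under the chain retains, up to the density factor `C ^ m` and a
polynomial factor, a proportional share of a type class close to `q`. -/
lemma IsStationaryChain.eventually_le_minLog (h : IsStationaryChain q U)
    (hL : f.IsUniformRefinement H q L) {C : ℝ} (hC1 : 1 ≤ C)
    (hC : ∀ a b, 0 < q a → U a b ≤ C * q b) {ε c : ℝ} (hε : 0 < ε) (hc0 : 0 < c) (hc1 : c < 1) :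
    ∀ᶠ m : ℕ in atTop, (m + 1 : ℕ) * (L - Real.logb 2 C - ε) ≤
      f.minLog (strongPow H (m + 1)) (chainWeight q U m) c := by
  obtain ⟨δ, hδ, hev⟩ := hL.exists_typicalCounts (half_pos hε)
  set lA := Real.log (Fintype.card A) with hlA
  have hlA0 : 0 ≤ lA := by positivity
  filter_upwards [(tendsto_add_atTop_nat 1).eventually hev,
    (tendsto_add_atTop_nat 1).eventually (eventually_log_le
      (1 - Real.logb 2 c + Real.logb 2 (lA + 2)) (Fintype.card A + 1) (half_pos hε)),
    h.eventually_mass_compl_typicalSet_le hδ (half_pos hc0)] with m h1 h2 h3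
  set n := m + 1 with hn
  have hn0 : (0 : ℝ) ≤ n := by positivity
  refine f.le_minLog _ hc0 (by rw [chainWeight_sum h]; exact hc1.le) fun S hSne hS => ?_
  let ν : (Fin n → A) → ℝ := fun w => ∏ i, q (w i)
  have hν : 0 ≤ ν := fun w => Finset.prod_nonneg fun i _ => h.init.1 _
  have hC0 : 0 < C := by linarith
  set P : ℝ := ((n : ℝ) + 1) ^ Fintype.card A with hP
  have hP1 : 1 ≤ P := one_le_pow₀ (by linarith)
  set κ : ℝ := 2 * C ^ m * P / c with hκ
  have hCm : 1 ≤ C ^ m := one_le_pow₀ hC1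
  have hκ1 : 1 ≤ κ := by
    rw [hκ, le_div_iff₀ hc0]
    nlinarith
  have hκ0 : 0 < κ := by linarith
  -- The typical part of `S` has weight at least `c / 2`.
  have hS1 : c / 2 ≤ mass (chainWeight q U m) (S ∩ typicalSet q δ n) := by
    have e1 : mass (chainWeight q U m) S ≤ mass (chainWeight q U m) (S ∩ typicalSet q δ n) +
        mass (chainWeight q U m) (typicalSet q δ n)ᶜ := by
      rw [mass, mass, mass, ← Finset.sum_add_distrib]
      refine Finset.sum_le_sum fun w _ => ?_
      have hw := chainWeight_nonneg h m w
      by_cases a1 : w ∈ S <;> by_cases a2 : w ∈ typicalSet q δ n <;> simp [a1, a2, hw]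
    linarith
  have hS2 : mass (chainWeight q U m) (S ∩ typicalSet q δ n) ≤
      C ^ m * ∑ d ∈ typicalCounts q δ n, mass ν (S ∩ countClass (Fin n) d) := by
    simp only [mass]
    rw [Finset.sum_comm, Finset.mul_sum]
    refine Finset.sum_le_sum fun w _ => ?_
    have hnn : ∀ T : Set (Fin n → A), 0 ≤ T.indicator ν w := fun T =>
      Set.indicator_nonneg (fun _ _ => hν _) w
    by_cases hw : w ∈ S ∩ typicalSet q δ n
    · rw [Set.indicator_of_mem hw]
      refine (chainWeight_le_iid h hC0.le hC m w).trans ?_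
      refine mul_le_mul_of_nonneg_left ?_ (by positivity)
      refine le_trans ?_ (Finset.single_le_sum (fun d _ => hnn _)
        (mem_typicalCounts.2 ⟨w, hw.2, rfl⟩))
      rw [Set.indicator_of_mem (Set.mem_inter hw.1 (mem_countClass_letterCount w))]
    · rw [Set.indicator_of_notMem hw]
      exact mul_nonneg (by positivity) (Finset.sum_nonneg fun d _ => hnn _)
  obtain ⟨d, hd, hdmass⟩ : ∃ d ∈ typicalCounts q δ n,
      1 / κ ≤ mass ν (S ∩ countClass (Fin n) d) := by
    by_contra! hcon
    have hne : (typicalCounts q δ n).Nonempty := by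
      rw [Finset.nonempty_iff_ne_empty]
      intro he
      rw [he, Finset.sum_empty, mul_zero] at hS2
      linarith
    have e1 := Finset.sum_lt_sum_of_nonempty hne hcon
    rw [Finset.sum_const, nsmul_eq_mul] at e1
    have e2 : ((typicalCounts q δ n).card : ℝ) ≤ P := by
      rw [hP]
      exact_mod_cast card_typicalCounts_le δ n
    have e3 : C ^ m * ∑ d ∈ typicalCounts q δ n, mass ν (S ∩ countClass (Fin n) d) <
        C ^ m * (P * (1 / κ)) := by
      refine mul_lt_mul_of_pos_left (e1.trans_le ?_) (by linarith)
      gcongr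
    have e4 : C ^ m * (P * (1 / κ)) = c / 2 := by
      rw [hκ]
      field_simp
    linarith
  obtain ⟨hd1, hd2⟩ := h1 d hd
  have hne : (S ∩ countClass (Fin n) d).Nonempty := by
    rw [Set.nonempty_iff_ne_empty]
    intro he
    rw [he, mass_empty] at hdmass
    have : 0 < 1 / κ := by positivity
    linarith
  obtain ⟨w₀, hw₀⟩ := hne
  have hconst : ∀ w ∈ countClass (Fin n) d, ν w = ν w₀ := fun w hw =>
    prod_eq_of_mem_countClass hw hw₀.2
  rw [mass_eq_card_mul _ fun w hw => hconst w hw.2] at hdmass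
  have hT : (Nat.card (countClass (Fin n) d) : ℝ) * ν w₀ ≤ 1 := by
    rw [← mass_eq_card_mul _ hconst, ← sum_prod_eq_one h.init n, ← mass_univ]
    exact mass_mono hν (Set.subset_univ _)
  have hcard : (Nat.card (countClass (Fin n) d) : ℝ) ≤
      κ * Nat.card ↥(S ∩ countClass (Fin n) d) := by
    have hx : 0 < ν w₀ := by
      refine (hν w₀).lt_of_ne fun h0 => ?_
      have h0' : ν w₀ = 0 := h0.symm
      rw [h0', mul_zero] at hdmass
      have : 0 < 1 / κ := by positivity
      linarith
    rw [div_le_iff₀ hκ0] at hdmass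
    refine le_of_mul_le_mul_right ?_ hx
    linarith
  have hval := f.countVal_le_mul_on H hd1 Set.inter_subset_right ⟨w₀, hw₀⟩ hκ1 hcard
  have hval2 : f.countVal H d ≤ κ * (n * lA + 2) * f.on (strongPow H n) S :=
    hval.trans (mul_le_mul_of_nonneg_left (f.on_mono Set.inter_subset_left) (by positivity))
  have hlog := Real.logb_le_logb_of_le one_lt_two (f.countVal_pos H d) hval2
  rw [Real.logb_mul (by positivity) (f.on_pos hSne).ne', Real.logb_mul hκ0.ne' (by positivity)]
    at hlog
  have hlogκ : Real.logb 2 κ = 1 + m * Real.logb 2 C + Fintype.card A * Real.logb 2 (n + 1) -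
      Real.logb 2 c := by
    rw [hκ, hP, Real.logb_div (by positivity) hc0.ne', Real.logb_mul (by positivity) (by positivity),
      Real.logb_mul (by norm_num) (by positivity), Real.logb_pow, Real.logb_pow,
      Real.logb_self_eq_one one_lt_two]
  have hlogA : Real.logb 2 (n * lA + 2) ≤ Real.logb 2 (n + 1) + Real.logb 2 (lA + 2) := by
    rw [← Real.logb_mul (by positivity) (by positivity)]
    exact Real.logb_le_logb_of_le one_lt_two (by positivity) (by nlinarith)
  have hlogC : (m : ℝ) * Real.logb 2 C ≤ n * Real.logb 2 C := by
    refine mul_le_mul_of_nonneg_right ?_ (Real.logb_nonneg one_lt_two hC1)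
    rw [hn]
    push_cast
    linarith
  have hcount := (abs_le.1 hd2).1
  unfold SpectralPoint.logCount at hcount
  linarith

end AEPBounds

/-! ### Walks in the transition graph -/

section Walks

variable {V : Type u} {W : V → V → ℝ}

/-- There is a walk of `n` steps of positive probability from `s` to `t`. -/
def HasWalk (W : V → V → ℝ) : ℕ → V → V → Prop
  | 0, s, t => s = t
  | n + 1, s, t => ∃ r, HasWalk W n s r ∧ 0 < W r t

lemma hasWalk_add {a b : ℕ} {s t : V} :
    HasWalk W (a + b) s t ↔ ∃ r, HasWalk W a s r ∧ HasWalk W b r t := by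
  induction b generalizing t with
  | zero => simp [HasWalk]
  | succ b ih =>
    constructor
    · rintro ⟨r', h, h3⟩
      obtain ⟨r, h1, h2⟩ := ih.1 h
      exact ⟨r, h1, r', h2, h3⟩
    · rintro ⟨r, h1, r', h2, h3⟩
      exact ⟨r', ih.2 ⟨r, h1, h2⟩, h3⟩

lemma HasWalk.mul {a : ℕ} {t : V} (h : HasWalk W a t t) (n : ℕ) : HasWalk W (a * n) t t := by
  induction n with
  | zero => rfl
  | succ n ih => exact hasWalk_add.2 ⟨t, ih, h⟩

lemma exists_hasWalk_of_reflTransGen {s t : V}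
    (h : Relation.ReflTransGen (fun s t => 0 < W s t) s t) : ∃ n, HasWalk W n s t := by
  induction h with
  | refl => exact ⟨0, rfl⟩
  | tail _ h2 ih =>
    obtain ⟨n, hn⟩ := ih
    exact ⟨n + 1, _, hn, h2⟩

variable [Fintype V] {p : V → ℝ}

/-- A common length of closed walks through all letters of the support. -/
lemma IsStationaryChain.exists_closed_walk (h : IsStationaryChain p W) :
    ∃ l > 0, ∀ t, 0 < p t → HasWalk W l t t := by
  classical
  have key : ∀ t, ∃ c > 0, 0 < p t → HasWalk W c t t := by
    intro t
    by_cases ht : 0 < p t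
    · obtain ⟨r, hr⟩ : ∃ r, 0 < W t r := by
        by_contra! hcon
        have : ∑ r, W t r ≤ 0 := Finset.sum_nonpos fun r _ => hcon r
        rw [(h.row t).2] at this
        linarith
      obtain ⟨n, hn⟩ := exists_hasWalk_of_reflTransGen (h.irred r t (h.pos_of_pos ht hr) ht)
      exact ⟨1 + n, by omega, fun _ => hasWalk_add.2 ⟨r, ⟨t, rfl, hr⟩, hn⟩⟩
    · exact ⟨1, one_pos, fun h => (ht h).elim⟩
  choose c hc0 hc using key
  refine ⟨∏ t, c t, Finset.prod_pos fun t _ => hc0 t, fun t ht => ?_⟩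
  rw [← Finset.mul_prod_erase _ _ (Finset.mem_univ t)]
  exact (hc t ht).mul _

end Walks

/-! ### The chain of blocks -/

section Blocks

variable {V : Type u} {p : V → ℝ} {W : V → V → ℝ}

/-- The transition matrix of the chain of consecutive blocks of length `j + 1`. -/
def blockKernel (W : V → V → ℝ) (j : ℕ) (u v : Fin (j + 1) → V) : ℝ :=
  chainWeight (W (u (Fin.last j))) W j v

lemma exists_block_of_hasWalk {j : ℕ} {s t : V} (h : HasWalk W (j + 1) s t) :
    ∃ v : Fin (j + 1) → V, 0 < chainWeight (W s) W j v ∧ v (Fin.last j) = t := by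
  induction j generalizing t with
  | zero =>
    obtain ⟨r, rfl, hr⟩ := h
    exact ⟨fun _ => t, by simpa [chainWeight] using hr, rfl⟩
  | succ j ih =>
    obtain ⟨r, h1, h2⟩ := h
    obtain ⟨v, hv1, hv2⟩ := ih h1
    refine ⟨Fin.snoc v t, ?_, Fin.snoc_last (α := fun _ => V) t v⟩
    rw [chainWeight_snoc, hv2]
    exact mul_pos hv1 h2

lemma exists_reflTransGen_block {j : ℕ} (u : Fin (j + 1) → V) (i : ℕ) {r : V}
    (h : HasWalk W (i * (j + 1)) (u (Fin.last j)) r) :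
    ∃ u' : Fin (j + 1) → V, Relation.ReflTransGen (fun s t => 0 < blockKernel W j s t) u u' ∧
      u' (Fin.last j) = r := by
  induction i generalizing r with
  | zero =>
    rw [zero_mul] at h
    exact ⟨u, Relation.ReflTransGen.refl, h⟩
  | succ i ih =>
    rw [Nat.succ_mul, hasWalk_add] at h
    obtain ⟨r', h1, h2⟩ := h
    obtain ⟨u', hu', rfl⟩ := ih h1
    obtain ⟨v, hv1, hv2⟩ := exists_block_of_hasWalk h2
    exact ⟨v, hu'.tail hv1, hv2⟩

variable [Fintype V]

lemma sum_chainWeight_mul_last (h : IsStationaryChain p W) (j : ℕ) (g : V → ℝ) :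
    ∑ v, chainWeight p W j v * g (v (Fin.last j)) = ∑ s, p s * g s := by
  induction j generalizing g with
  | zero =>
    rw [← (Equiv.funUnique (Fin 1) V).sum_comp fun s => p s * g s]
    simp [chainWeight]
  | succ j ih =>
    rw [sum_snoc]
    simp only [chainWeight_snoc, Fin.snoc_last (α := fun _ => V), mul_assoc, ← Finset.mul_sum]
    rw [ih fun s => ∑ v, W s v * g v]
    simp only [Finset.mul_sum]
    rw [Finset.sum_comm]
    simp only [← mul_assoc, ← Finset.sum_mul, h.stat]

/-- If every letter of the support has a closed walk of length `j`, then the chain of blocks of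
length `j + 1`, which is prime to `j`, is irreducible on its support. -/
lemma IsStationaryChain.block (h : IsStationaryChain p W) {j : ℕ} (hj : 0 < j)
    (hwalk : ∀ t, 0 < p t → HasWalk W j t t) :
    IsStationaryChain (chainWeight p W j) (blockKernel W j) where
  init := chainWeight_mem_stdSimplex h j
  row u := chainWeight_mem_stdSimplex_of_row (h.row _) h.row j
  stat v := by
    unfold blockKernel
    rw [sum_chainWeight_mul_last h j fun s => chainWeight (W s) W j v]
    unfold chainWeight
    simp only [← mul_assoc, ← Finset.sum_mul, h.stat]
  irred u v hu hv := by
    have hs := pos_of_chainWeight_ne_zero h hu.ne' (Fin.last j)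
    have ht := pos_of_chainWeight_ne_zero h hv.ne' 0
    obtain ⟨l, hl⟩ := exists_hasWalk_of_reflTransGen (h.irred _ _ hs ht)
    have hlong := hasWalk_add.2 ⟨_, hl, (hwalk _ ht).mul (l + j)⟩
    -- The number of closed walks is chosen to make the total length `1` modulo `j + 1`.
    obtain ⟨j', rfl⟩ : ∃ j', j = j' + 1 := ⟨j - 1, by omega⟩
    have e : l + (j' + 1) * (l + (j' + 1)) = (l + j') * (j' + 1 + 1) + 1 := by ring
    rw [e] at hlong
    obtain ⟨r, h1, h2⟩ := hlong
    obtain ⟨u', hu', rfl⟩ := exists_reflTransGen_block u _ h1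
    refine hu'.tail (mul_pos h2 ?_)
    exact pos_of_mul_pos_right hv (h.init.1 _)

lemma IsStationaryChain.exists_density_bound (h : IsStationaryChain p W) :
    ∃ C, 1 ≤ C ∧ ∀ a b, 0 < p a → W a b ≤ C * p b := by
  have hp : ∀ s, 0 ≤ (p s)⁻¹ := fun s => inv_nonneg.2 (h.init.1 s)
  refine ⟨1 + ∑ s, (p s)⁻¹, le_add_of_nonneg_right (Finset.sum_nonneg fun s _ => hp s),
    fun a b ha => ?_⟩
  have h1 : p a * W a b ≤ p b := by
    rw [← h.stat b]
    exact Finset.single_le_sum (f := fun a => p a * W a b)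
      (fun a _ => mul_nonneg (h.init.1 a) ((h.row a).1 b)) (Finset.mem_univ a)
  have h2 : (p a)⁻¹ ≤ 1 + ∑ s, (p s)⁻¹ :=
    (Finset.single_le_sum (fun s _ => hp s) (Finset.mem_univ a)).trans (by linarith)
  calc W a b = (p a)⁻¹ * (p a * W a b) := by field_simp
    _ ≤ (1 + ∑ s, (p s)⁻¹) * p b :=
      mul_le_mul h2 h1 (mul_nonneg ha.le ((h.row a).1 b)) ((hp a).trans h2)

/-- The density bound of a chain is inherited by its block chains with the same constant. -/
lemma blockKernel_le (h : IsStationaryChain p W) {C : ℝ}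
    (hC : ∀ a b, 0 < p a → W a b ≤ C * p b) (j : ℕ) (u v : Fin (j + 1) → V)
    (hu : 0 < chainWeight p W j u) : blockKernel W j u v ≤ C * chainWeight p W j v := by
  unfold blockKernel
  have hs := pos_of_chainWeight_ne_zero h hu.ne' (Fin.last j)
  unfold chainWeight
  rw [← mul_assoc]
  exact mul_le_mul_of_nonneg_right (hC _ _ hs) (Finset.prod_nonneg fun _ _ => (h.row _).1 _)

lemma chainWeight_eq_prod_range {V : Type u} (p : V → ℝ) (W : V → V → ℝ) (n : ℕ) (x : ℕ → V) :
    chainWeight p W n (fun i => x i) = p (x 0) * ∏ i ∈ Finset.range n, W (x i) (x (i + 1)) := by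
  rw [Finset.prod_range]
  rfl

lemma chainWeight_block {V : Type u} (p : V → ℝ) (W : V → V → ℝ) (j m : ℕ) (x : ℕ → V) :
    chainWeight (chainWeight p W j) (blockKernel W j) m (fun a b => x (b + (j + 1) * a)) =
      p (x 0) * ∏ i ∈ Finset.range ((j + 1) * m + j), W (x i) (x (i + 1)) := by
  have h0 := chainWeight_eq_prod_range (chainWeight p W j) (blockKernel W j) m
    (fun a (b : Fin (j + 1)) => x (b + (j + 1) * a))
  refine h0.trans ?_
  clear h0
  induction m with
  | zero =>
    simpa using chainWeight_eq_prod_range p W j x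
  | succ m ih =>
    rw [Finset.prod_range_succ, ← mul_assoc, ih]
    have e : (j + 1) * (m + 1) + j = ((j + 1) * m + j) + (1 + j) := by ring
    rw [e, Finset.prod_range_add _ ((j + 1) * m + j), add_comm 1 j, Finset.prod_range_succ' _ j,
      mul_assoc (p (x 0))]
    congr 2
    have h1 := chainWeight_eq_prod_range (W (x ((j + 1) * m + j))) W j
      (fun b => x (b + (j + 1) * (m + 1)))
    unfold blockKernel
    have h2 : ((Fin.last j : Fin (j + 1)) : ℕ) + (j + 1) * m = (j + 1) * m + j := by
      rw [Fin.val_last, add_comm]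
    beta_reduce
    rw [h2, h1, mul_comm]
    congr 1
    · refine Finset.prod_congr rfl fun i _ => ?_
      congr 2 <;> ring
    · congr 2
      ring

end Blocks

/-! ### Cutting words into blocks -/

section BlockMap

variable {V : Type u}

/-- Cutting a word of length `m * k + r` into `m` blocks of length `k`, discarding the rest. -/
def blockMap (m k r : ℕ) (x : Fin (m * k + r) → V) (a : Fin m) (b : Fin k) : V :=
  x (Fin.castAdd r (finProdFinEquiv (a, b)))

lemma blockMap_compl_adj {G : SimpleGraph V} {m k r : ℕ} {x y : Fin (m * k + r) → V} :
    (strongPow (strongPow G k) m)ᶜ.Adj (blockMap m k r x) (blockMap m k r y) ↔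
      ∃ i : Fin (m * k), Gᶜ.Adj (x (Fin.castAdd r i)) (y (Fin.castAdd r i)) := by
  simp only [strongPow_eq_powGraph, powGraph_compl_adj, blockMap]
  constructor
  · rintro ⟨a, b, h⟩
    exact ⟨_, h⟩
  · rintro ⟨i, h⟩
    obtain ⟨⟨a, b⟩, rfl⟩ := finProdFinEquiv.surjective i
    exact ⟨a, b, h⟩

variable [Fintype V] (f : SpectralPoint.{u}) (G : SimpleGraph V)

lemma SpectralPoint.minLog_le_minLog {X : Type u} [Fintype X] {H K : SimpleGraph X}
    (hHK : ∀ x y, Hᶜ.Adj x y → Kᶜ.Adj x y) {ν : X → ℝ} {c : ℝ} (hc0 : 0 < c)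
    (hc : c ≤ ∑ x, ν x) : f.minLog H ν c ≤ f.minLog K ν c := by
  refine f.le_minLog _ hc0 hc fun S hne hS => (f.minLog_le _ hS).trans ?_
  exact Real.logb_le_logb_of_le one_lt_two (f.on_pos hne)
    (f.on_le_on id (fun _ h => h) fun x _ y _ => hHK x y)

lemma SpectralPoint.minLog_block_le [DecidableEq V] {m k r : ℕ} {ν : (Fin (m * k + r) → V) → ℝ}
    (hν : ν ∈ stdSimplex ℝ (Fin (m * k + r) → V)) {c : ℝ} (hc0 : 0 < c) (hc1 : c ≤ 1) :
    f.minLog (strongPow (strongPow G k) m) (pushWeight (blockMap m k r) ν) c ≤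
      f.minLog (strongPow G (m * k + r)) ν c := by
  rw [← f.minLog_pullback _ _ hν hc0 hc1]
  refine f.minLog_le_minLog (fun x y h => ?_) hc0 (by rwa [hν.2])
  rw [pullbackGraph_compl_adj, blockMap_compl_adj] at h
  rw [strongPow_eq_powGraph, powGraph_compl_adj]
  obtain ⟨i, hi⟩ := h
  exact ⟨_, hi⟩

/-- The discarded letters cost at most their number times `log |V|`. -/
lemma SpectralPoint.minLog_le_block [DecidableEq V] {m k r : ℕ} {ν : (Fin (m * k + r) → V) → ℝ}
    (hν : ν ∈ stdSimplex ℝ (Fin (m * k + r) → V)) {c : ℝ} (hc0 : 0 < c) (hc1 : c ≤ 1) :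
    f.minLog (strongPow G (m * k + r)) ν c ≤
      f.minLog (strongPow (strongPow G k) m) (pushWeight (blockMap m k r) ν) c +
        r * Real.logb 2 (Fintype.card V) := by
  rw [← sub_le_iff_le_add]
  refine f.le_minLog _ hc0 (by rwa [(pushWeight_mem_stdSimplex _ hν).2]) fun S hSne hS => ?_
  rw [mass_pushWeight] at hS
  rw [sub_le_iff_le_add]
  refine (f.minLog_le _ hS).trans ?_
  have hne : (blockMap m k r ⁻¹' S).Nonempty := by
    rw [Set.nonempty_iff_ne_empty]
    intro h0
    rw [h0, mass_empty] at hS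
    linarith
  let T : (Fin r → V) → Set (Fin (m * k + r) → V) := fun z =>
    {x | blockMap m k r x ∈ S ∧ ∀ i, x (Fin.natAdd (m * k) i) = z i}
  have hT : ∀ z, f.on (strongPow G (m * k + r)) (T z) ≤ f.on (strongPow (strongPow G k) m) S := by
    intro z
    refine f.on_le_on (blockMap m k r) (fun x hx => hx.1) fun x hx y hy h => ?_
    rw [blockMap_compl_adj]
    rw [strongPow_eq_powGraph, powGraph_compl_adj] at h
    obtain ⟨i, hi⟩ := h
    induction i using Fin.addCases with
    | left i => exact ⟨i, hi⟩
    | right i =>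
      rw [hx.2, hy.2] at hi
      exact (hi.ne rfl).elim
  have hcover : blockMap m k r ⁻¹' S ⊆ ⋃ z ∈ (Finset.univ : Finset (Fin r → V)), T z := by
    intro x hx
    exact Set.mem_biUnion (x := fun i => x (Fin.natAdd (m * k) i)) (Finset.mem_univ _)
      ⟨hx, fun _ => rfl⟩
  have hle : f.on (strongPow G (m * k + r)) (blockMap m k r ⁻¹' S) ≤
      (Fintype.card V : ℝ) ^ r * f.on (strongPow (strongPow G k) m) S := by
    refine (f.on_mono hcover).trans ((f.on_biUnion_le _ _ _).trans
      ((Finset.sum_le_sum fun z _ => hT z).trans ?_))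
    simp
  have hV : (0 : ℝ) < (Fintype.card V : ℝ) ^ r := by
    by_contra! hcon
    have h1 := f.on_pos (H := strongPow G (m * k + r)) hne
    have h2 := f.on_pos (H := strongPow (strongPow G k) m) hSne
    nlinarith
  have hlog := Real.logb_le_logb_of_le one_lt_two (f.on_pos hne) hle
  rw [Real.logb_mul hV.ne' (f.on_pos hSne).ne', Real.logb_pow] at hlog
  linarith

end BlockMap

/-! ### Asymptotic equipartition for Markov sources -/

section MarkovSource

variable {V : Type u} [Fintype V] [MeasurableSpace V] [DiscreteMeasurableSpace V]
  {μ : Measure (ℕ → V)} [IsProbabilityMeasure μ] {p : V → ℝ} {W : V → V → ℝ}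

/-- The blocks cut from a stretch of the Markov chain form a Markov chain. -/
lemma pushWeight_blockMap_marginal [DecidableEq V]
    (hμ : ∀ (n : ℕ) (w : Fin (n + 1) → V), marginal μ (n + 1) w = chainWeight p W n w)
    (m j r : ℕ) : pushWeight (blockMap (m + 1) (j + 1) r) (marginal μ ((m + 1) * (j + 1) + r)) =
      chainWeight (chainWeight p W j) (blockKernel W j) m := by
  ext w
  have hV : Nonempty V := ⟨w 0 0⟩
  -- An infinite sequence that starts with the concatenation of the blocks of `w`.
  let y : Fin ((m + 1) * (j + 1)) → V := fun i =>
    w (finProdFinEquiv.symm i).1 (finProdFinEquiv.symm i).2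
  let x : ℕ → V := fun i => if h : i < (m + 1) * (j + 1) then y ⟨i, h⟩ else Classical.arbitrary V
  have hxy : (fun i : Fin ((m + 1) * (j + 1)) => x i) = y := by
    ext i
    simp [x]
  have hxw : (fun (a : Fin (m + 1)) (b : Fin (j + 1)) => x (b + (j + 1) * a)) = w := by
    ext a b
    have h1 : ((finProdFinEquiv (a, b) : Fin ((m + 1) * (j + 1))) : ℕ) = b + (j + 1) * a := rfl
    rw [← h1]
    have h2 := congrFun hxy (finProdFinEquiv (a, b))
    rw [h2]
    simp only [y, Equiv.symm_apply_apply]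
  have hmarg : marginal μ ((m + 1) * (j + 1)) y =
      chainWeight (chainWeight p W j) (blockKernel W j) m w := by
    have e : (m + 1) * (j + 1) = ((j + 1) * m + j) + 1 := by ring
    have h3 := chainWeight_block p W j m x
    rw [hxw] at h3
    rw [h3, ← hxy]
    have h4 := (hμ ((j + 1) * m + j) fun i => x i).trans (chainWeight_eq_prod_range p W _ x)
    rw [← h4]
    generalize (m + 1) * (j + 1) = N at e
    subst e
    rfl
  rw [← hmarg, marginal_eq_pushWeight_castLE μ ((m + 1) * (j + 1))
    ((m + 1) * (j + 1) + r) (Nat.le_add_right _ r)]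
  refine Finset.sum_congr rfl fun z _ => if_congr ?_ rfl rfl
  constructor
  · rintro rfl
    ext i
    simp only [y, blockMap, Prod.mk.eta, Equiv.apply_symm_apply]
    rfl
  · intro hz
    ext a b
    have := congrFun hz (finProdFinEquiv (a, b))
    simp only [y, Equiv.symm_apply_apply] at this
    rw [← this]
    rfl

variable {f : SpectralPoint.{u}} {G : SimpleGraph V}

lemma eventually_atTop_of_mul_add {P : ℕ → Prop} {k M : ℕ} (hk : 0 < k)
    (h : ∀ m ≥ M, ∀ r < k, P ((m + 1) * k + r)) : ∀ᶠ n in atTop, P n := by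
  refine eventually_atTop.2 ⟨(M + 1) * k, fun n hn => ?_⟩
  have h1 : M + 1 ≤ n / k := (Nat.le_div_iff_mul_le hk).2 hn
  have h2 := h (n / k - 1) (by omega) (n % k) (Nat.mod_lt n hk)
  rw [Nat.sub_add_cancel (by omega), mul_comm, Nat.div_add_mod] at h2
  exact h2

/-- For a block length `j + 1` with irreducible block chain, the normalized value of the cheapest
sets of weight at least `c` lies asymptotically between `(F_{j + 1} - log C) / (j + 1)` and
`F_{j + 1} / (j + 1)`, where `F_{j + 1}` is the refinement at the law of a block. -/
lemma eventually_minLogRate_bounds (h : IsStationaryChain p W)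
    (hμ : ∀ (n : ℕ) (w : Fin (n + 1) → V), marginal μ (n + 1) w = chainWeight p W n w)
    {C : ℝ} (hC1 : 1 ≤ C) (hC : ∀ a b, 0 < p a → W a b ≤ C * p b)
    {j : ℕ} (hj : 0 < j) (hwalk : ∀ t, 0 < p t → HasWalk W j t t) {F : ℝ}
    (hF : f.IsUniformRefinement (strongPow G (j + 1)) (marginal μ (j + 1)) F)
    {ε c : ℝ} (hε : 0 < ε) (hc0 : 0 < c) (hc1 : c < 1) :
    ∀ᶠ n in atTop, (F - Real.logb 2 C) / (j + 1 : ℕ) - ε ≤ minLogRate f G μ c n ∧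
      minLogRate f G μ c n ≤ F / (j + 1 : ℕ) + ε := by
  classical
  have hq : marginal μ (j + 1) = chainWeight p W j := funext (hμ j)
  rw [hq] at hF
  have hblock := h.block hj hwalk
  obtain ⟨M, hM⟩ := eventually_atTop.1 ((hblock.eventually_minLog_le hF (half_pos hε) hc0 hc1).and
    (hblock.eventually_le_minLog hF hC1 (fun u v hu => blockKernel_le h hC j u v hu) (half_pos hε)
      hc0 hc1))
  set k : ℝ := ((j + 1 : ℕ) : ℝ) with hk
  have hk1 : 1 ≤ k := by
    rw [hk]
    push_cast
    linarith [Nat.cast_nonneg (α := ℝ) j]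
  have hk0 : 0 < k := by linarith
  set lV := Real.logb 2 (Fintype.card V) with hlV
  -- Bounded errors from the incomplete last block.
  set B : ℝ := |F| + |F - Real.logb 2 C| + k * |lV| with hB
  have hlarge : ∀ᶠ n : ℕ in atTop, 0 < n ∧ B ≤ ε / 2 * n :=
    (eventually_gt_atTop 0).and <| by
      filter_upwards [tendsto_natCast_atTop_atTop.eventually_ge_atTop (B / (ε / 2))] with n hn
      rw [div_le_iff₀ (half_pos hε)] at hn
      linarith
  have hev : ∀ᶠ n : ℕ in atTop, ∃ m ≥ M, ∃ r < j + 1, n = (m + 1) * (j + 1) + r :=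
    eventually_atTop_of_mul_add (M := M) (Nat.succ_pos j) fun m hm r hr => ⟨m, hm, r, hr, rfl⟩
  filter_upwards [hlarge, hev] with n hn hex
  obtain ⟨hn0, hnB⟩ := hn
  obtain ⟨m, hm, r, hr, rfl⟩ := hex
  obtain ⟨hup, hlow⟩ := hM m hm
  have hν := marginal_mem_stdSimplex μ ((m + 1) * (j + 1) + r)
  have h1 := f.minLog_block_le G hν hc0 hc1.le
  have h2 := f.minLog_le_block G hν hc0 hc1.le
  rw [pushWeight_blockMap_marginal hμ] at h1 h2
  rw [minLogRate_eq]
  set N : ℝ := (((m + 1) * (j + 1) + r : ℕ) : ℝ) with hN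
  have hN0 : 0 < N := Nat.cast_pos.2 hn0
  have hNk : N = (m + 1 : ℕ) * k + r := by
    rw [hN, hk]
    push_cast
    ring
  have hrk : (r : ℝ) ≤ k := by
    rw [hk]
    exact_mod_cast hr.le
  have hr0 : (0 : ℝ) ≤ r := Nat.cast_nonneg r
  have hmN : ((m + 1 : ℕ) : ℝ) ≤ N := by
    have : (0 : ℝ) ≤ (m + 1 : ℕ) := Nat.cast_nonneg _
    nlinarith
  -- Replacing the number of blocks by `N / k` costs a bounded amount.
  have hrep : ∀ y : ℝ, |(m + 1 : ℕ) * y - N * (y / k)| ≤ |y| := by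
    intro y
    have : (m + 1 : ℕ) * y - N * (y / k) = -(y * (r / k)) := by
      rw [hNk]
      field_simp
      ring
    rw [this, abs_neg, abs_mul, abs_of_nonneg (div_nonneg hr0 hk0.le)]
    exact mul_le_of_le_one_right (abs_nonneg y) ((div_le_one hk0).2 hrk)
  have hrV : (r : ℝ) * lV ≤ k * |lV| := by
    calc (r : ℝ) * lV ≤ r * |lV| := by gcongr; exact le_abs_self lV
      _ ≤ k * |lV| := by gcongr
  have hmε : ((m + 1 : ℕ) : ℝ) * (ε / 2) ≤ N * (ε / 2) := by gcongr
  have hF1 := abs_le.1 (hrep F)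
  have hF2 := abs_le.1 (hrep (F - Real.logb 2 C))
  have hF0 := abs_nonneg F
  have hF0' := abs_nonneg (F - Real.logb 2 C)
  have hkV : 0 ≤ k * |lV| := by positivity
  rw [one_div, ← div_eq_inv_mul, le_div_iff₀ hN0, div_le_iff₀ hN0]
  constructor <;> linarith

/-- The refinement at the marginals of a source is nondecreasing in the length of the words, as
dropping letters preserves indistinguishability. -/
lemma refinement_marginal_mono {m n : ℕ} (hmn : m ≤ n) {a b : ℝ}
    (ha : HasRefinement f (strongPow G m) (marginal μ m) a)
    (hb : HasRefinement f (strongPow G n) (marginal μ n) b) : a ≤ b := by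
  classical
  rw [marginal_eq_pushWeight_castLE μ m n hmn] at ha
  refine HasRefinement.le_of_compl_le (marginal_mem_stdSimplex μ n) ?_ ha.pullback hb
  intro x y hxy
  rw [pullbackGraph_compl_adj, strongPow_eq_powGraph, powGraph_compl_adj] at hxy
  rw [strongPow_eq_powGraph, powGraph_compl_adj]
  obtain ⟨i, hi⟩ := hxy
  exact ⟨_, hi⟩

/-- If the nondecreasing sequence `a` satisfies `a n / n → R` with error `O(1 / n)` along an
arithmetic progression, then `a n / n → R`. -/
lemma tendsto_div_of_monotone_of_progression {a : ℕ → ℝ} (ha : Monotone a) {R K : ℝ} {l : ℕ}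
    (hl : 0 < l) (h : ∀ r ≥ 1, |a (l * r + 1) - (l * r + 1 : ℕ) * R| ≤ K) :
    Tendsto (fun n : ℕ => 1 / (n : ℝ) * a n) atTop (𝓝 R) := by
  rw [tendsto_iff_dist_tendsto_zero]
  refine squeeze_zero' (Eventually.of_forall fun n => dist_nonneg) ?_
    (tendsto_const_div_atTop_nhds_zero_nat (K + l * |R|))
  filter_upwards [eventually_ge_atTop (l + 1)] with n hn
  have hn0 : (0 : ℝ) < n := by exact_mod_cast (by omega : 0 < n)
  set r := (n - 1) / l with hr
  have hr1 : 1 ≤ r := (Nat.le_div_iff_mul_le hl).2 (by omega)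
  have hdm := Nat.div_add_mod (n - 1) l
  have hmod := Nat.mod_lt (n - 1) hl
  rw [← hr] at hdm
  have h1 : l * r + 1 ≤ n := by omega
  have h2 : n ≤ l * (r + 1) + 1 := by
    rw [mul_add]
    omega
  have b1 := abs_le.1 (h r hr1)
  have b2 := abs_le.1 (h (r + 1) (by omega))
  have m1 := ha h1
  have m2 := ha h2
  have e1 : (n : ℝ) - (l * r + 1 : ℕ) ≤ l := by
    have : n ≤ l + (l * r + 1) := by
      rw [mul_add] at h2
      omega
    have h3 : (n : ℝ) ≤ l + (l * r + 1 : ℕ) := by exact_mod_cast this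
    linarith
  have e1' : (0 : ℝ) ≤ (n : ℝ) - (l * r + 1 : ℕ) := by
    rw [sub_nonneg]
    exact_mod_cast h1
  have e2 : ((l * (r + 1) + 1 : ℕ) : ℝ) - n ≤ l := by
    have : l * (r + 1) + 1 ≤ l + n := by
      rw [mul_add]
      omega
    have h3 : ((l * (r + 1) + 1 : ℕ) : ℝ) ≤ l + n := by exact_mod_cast this
    linarith
  have e2' : (0 : ℝ) ≤ ((l * (r + 1) + 1 : ℕ) : ℝ) - n := by
    rw [sub_nonneg]
    exact_mod_cast h2
  have c1 : |((n : ℝ) - (l * r + 1 : ℕ)) * R| ≤ l * |R| := by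
    rw [abs_mul, abs_of_nonneg e1']
    gcongr
  have c2 : |(((l * (r + 1) + 1 : ℕ) : ℝ) - n) * R| ≤ l * |R| := by
    rw [abs_mul, abs_of_nonneg e2']
    gcongr
  have d1 := abs_le.1 c1
  have d2 := abs_le.1 c2
  have e : 1 / (n : ℝ) * a n - R = (a n - n * R) / n := by field_simp
  rw [Real.dist_eq, e, abs_div, abs_of_pos hn0]
  gcongr
  rw [abs_le]
  constructor <;> linarith

/-- The upper and lower bounds for two block lengths compare the quotients `F_k / k`, which squeezes
both these quotients and the rates of the cheapest sets to a common limit. -/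
lemma IsIrreducibleStationaryMarkov.exists_rate (hμ : IsIrreducibleStationaryMarkov μ)
    (f : SpectralPoint.{u}) (G : SimpleGraph V) :
    ∃ R : ℝ, HasFRate f G μ R ∧
      ∀ c ∈ Set.Ioo (0 : ℝ) 1, Tendsto (minLogRate f G μ c) atTop (𝓝 R) := by
  obtain ⟨p, W, h1, h2, h3, h4, h5⟩ := hμ
  have h : IsStationaryChain p W := ⟨h1, h2, h3, h4⟩
  obtain ⟨C, hC1, hC⟩ := h.exists_density_bound
  obtain ⟨l, hl, hwalk⟩ := h.exists_closed_walk
  choose F hF using fun n => f.exists_isUniformRefinement (strongPow G n)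
    (marginal_mem_stdSimplex μ n)
  set lC := Real.logb 2 C with hlC
  have hlC0 : 0 ≤ lC := Real.logb_nonneg one_lt_two hC1
  let k : ℕ → ℕ := fun r => l * (r + 1) + 1
  have hk0 : ∀ r, (0 : ℝ) < k r := fun r => Nat.cast_pos.2 (Nat.succ_pos _)
  have hbound : ∀ r, ∀ ε > 0, ∀ c ∈ Set.Ioo (0 : ℝ) 1, ∀ᶠ n in atTop,
      (F (k r) - lC) / k r - ε ≤ minLogRate f G μ c n ∧
        minLogRate f G μ c n ≤ F (k r) / k r + ε := fun r ε hε c hc =>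
    eventually_minLogRate_bounds h h5 hC1 hC (mul_pos hl (Nat.succ_pos r))
      (fun t ht => (hwalk t ht).mul _) (hF (k r)) hε hc.1 hc.2
  have hcomp : ∀ r s, (F (k r) - lC) / k r ≤ F (k s) / k s := by
    intro r s
    refine le_of_forall_pos_le_add fun ε hε => ?_
    obtain ⟨n, hn1, hn2⟩ := ((hbound r (ε / 2) (half_pos hε) (1 / 2) (by norm_num)).and
      (hbound s (ε / 2) (half_pos hε) (1 / 2) (by norm_num))).exists
    linarith [hn1.1, hn2.2]
  have hbdd : BddBelow (Set.range fun s => F (k s) / k s) :=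
    ⟨(F (k 0) - lC) / k 0, by rintro _ ⟨s, rfl⟩; exact hcomp 0 s⟩
  set R := ⨅ s, F (k s) / k s with hR
  have hR1 : ∀ r, R ≤ F (k r) / k r := fun r => ciInf_le hbdd r
  have hR2 : ∀ r, (F (k r) - lC) / k r ≤ R := fun r => le_ciInf (hcomp r)
  refine ⟨R, ⟨F, fun n => (hF n).hasRefinement, ?_⟩, fun c hc => ?_⟩
  · refine tendsto_div_of_monotone_of_progression (K := lC) (fun m n hmn =>
      refinement_marginal_mono hmn (hF m).hasRefinement (hF n).hasRefinement) hl fun r hr => ?_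
    obtain ⟨s, rfl⟩ : ∃ s, r = s + 1 := ⟨r - 1, by omega⟩
    have b1 := hR1 s
    have b2 := hR2 s
    rw [le_div_iff₀ (hk0 s)] at b1
    rw [div_le_iff₀ (hk0 s)] at b2
    simp only [k] at b1 b2
    rw [abs_le]
    constructor <;> linarith
  · rw [Metric.tendsto_atTop']
    intro ε hε
    obtain ⟨r, hr⟩ : ∃ r : ℕ, lC / k r < ε / 2 := by
      obtain ⟨r, hr⟩ := exists_nat_gt (lC / (ε / 2))
      refine ⟨r, ?_⟩
      rw [div_lt_iff₀ (half_pos hε)] at hr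
      rw [div_lt_iff₀ (hk0 r)]
      have : (r : ℝ) ≤ k r := by
        have h6 : r ≤ k r := by
          simp only [k]
          nlinarith
        exact_mod_cast h6
      nlinarith
    obtain ⟨N, hN⟩ := eventually_atTop.1 (hbound r (ε / 2) (half_pos hε) c hc)
    refine ⟨N, fun n hn => ?_⟩
    obtain ⟨u1, u2⟩ := hN n hn.le
    have b1 := hR1 r
    have b2 := hR2 r
    rw [sub_div] at u1 b2
    rw [Real.dist_eq, abs_lt]
    constructor <;> linarith

end MarkovSource

theorem mainTheorem2 {V Z : Type u}
    [Fintype V] [MeasurableSpace V] [DiscreteMeasurableSpace V]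
    [Fintype Z] [MeasurableSpace Z] [DiscreteMeasurableSpace Z]
    (G : SimpleGraph V) (φ : Z → V) (μ : Measure (ℕ → Z)) [IsProbabilityMeasure μ] :
    (HasAEP G (μ.map (fun z n => φ (z n))) ↔ HasAEP (pullbackGraph φ G) μ) ∧
    (∀ (f : SpectralPoint.{u}) (R : ℝ),
      HasFRate f G (μ.map (fun z n => φ (z n))) R ↔ HasFRate f (pullbackGraph φ G) μ R) ∧
    (IsIrreducibleStationaryMarkov μ →
      HasAEP G (μ.map (fun z n => φ (z n))) ∧
      ∀ f : SpectralPoint.{u}, ∃ R : ℝ,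
        HasFRate f G (μ.map (fun z n => φ (z n))) R ∧
        ∀ c ∈ Set.Ioo (0 : ℝ) 1,
          Tendsto (minLogRate f G (μ.map (fun z n => φ (z n))) c) atTop (𝓝 R)) := by
  classical
  have hmeas : Measurable fun (z : ℕ → Z) (n : ℕ) => φ (z n) :=
    measurable_pi_lambda _ fun i => (measurable_of_finite φ).comp (measurable_pi_apply i)
  have : IsProbabilityMeasure (μ.map fun z n => φ (z n)) :=
    Measure.isProbabilityMeasure_map hmeas.aemeasurable
  have hrate : ∀ (f : SpectralPoint.{u}), ∀ c ∈ Set.Ioo (0 : ℝ) 1,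
      minLogRate f G (μ.map fun z n => φ (z n)) c = minLogRate f (pullbackGraph φ G) μ c := by
    intro f c hc
    ext n
    rw [minLogRate_eq, minLogRate_eq, marginal_map, strongPow_pullbackGraph,
      f.minLog_pullback _ _ (marginal_mem_stdSimplex μ n) hc.1 hc.2.le]
  have hAEP : HasAEP G (μ.map fun z n => φ (z n)) ↔ HasAEP (pullbackGraph φ G) μ :=
    forall_congr' fun f => exists_congr fun L => forall₂_congr fun c hc => by rw [hrate f c hc]
  have hpull : ∀ (f : SpectralPoint.{u}) (n : ℕ) (a : ℝ),
      HasRefinement f (strongPow G n) (marginal (μ.map fun z n => φ (z n)) n) a →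
      HasRefinement f (strongPow (pullbackGraph φ G) n) (marginal μ n) a := by
    intro f n a ha
    rw [marginal_map] at ha
    rw [strongPow_pullbackGraph]
    exact ha.pullback
  have hF : ∀ (f : SpectralPoint.{u}) (R : ℝ),
      HasFRate f G (μ.map fun z n => φ (z n)) R ↔ HasFRate f (pullbackGraph φ G) μ R := by
    intro f R
    constructor
    · rintro ⟨a, ha, hlim⟩
      exact ⟨a, fun n => hpull f n _ (ha n), hlim⟩
    · rintro ⟨a, ha, hlim⟩
      refine ⟨a, fun n => ?_, hlim⟩
      obtain ⟨b, hb⟩ := f.exists_isUniformRefinement (strongPow G n)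
        (marginal_mem_stdSimplex (μ.map fun z n => φ (z n)) n)
      rw [(ha n).unique (marginal_mem_stdSimplex μ n) (hpull f n b hb.hasRefinement)]
      exact hb.hasRefinement
  refine ⟨hAEP, hF, fun hM => ⟨hAEP.2 fun f => ?_, fun f => ?_⟩⟩
  · obtain ⟨R, -, hR⟩ := hM.exists_rate f (pullbackGraph φ G)
    exact ⟨R, hR⟩
  · obtain ⟨R, hR1, hR2⟩ := hM.exists_rate f (pullbackGraph φ G)
    exact ⟨R, (hF f R).2 hR1, fun c hc => by rw [hrate f c hc]; exact hR2 c hc⟩
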